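/- Let $G$ be a $\Delta$-pure Garside group of finite type, with Garside structure $(G^+,\Delta)$, prefix order $g\preccurlyeq h\iff g^{-1}h\in G^+$, suffix order $g\succcurlyeq h\iff gh^{-1}\in G^+$, and finite set of simple elements $\mathcal D=\{s\in G^+ : s\preccurlyeq\Delta\}$. Here $\Delta$-pure means that $\Delta_a=\Delta_b$ for all atoms $a,b$ of $G^+$, where $\Delta_a$ is the least common right multiple of all elements $b^{-1}(b\vee a)$, $b\in G^+$. For $g\in G$ put $\inf(g)=\max\{r\in\mathbb Z:\Delta^r\preccurlyeq g\}$, $\sup(g)=\min\{s\in\mathbb Z:g\preccurlyeq\Delta^s\}$, $\ell(g)=\sup(g)-\inf(g)$ and $\underline g=g\Delta^{-\inf(g)}$. Let $\mathcal X$ be the graph whose vertices are the cosets $g\langle\Delta\rangle$, where $g\langle\Delta\rangle$ and $h\langle\Delta\rangle$ are adjacent if $\underline g\,s\in h\langle\Delta\rangle$ for some $s\in\mathcal D\setminus\{1,\Delta\}$, and let $d_{\mathcal X}$ be its graph metric, considered on the vertex set. Let $x\in G$ satisfy $\inf(x)=0$ and assume the following. * $x$ is right-rigid: if $x=x_r\cdots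 x_1$ is its right normal form (that is, $r\geqslant 1$, $x_i\in\mathcal D\setminus\{1,\Delta\}$, and for $1\leqslant i<r$ the greatest common suffix of $\Delta x_i^{-1}$ and $x_{i+1}$ is $1$), then the greatest common suffix of $x_1$ and $\Delta x_r^{-1}$ is $1$. * $x$ is Morse: the map $t\mapsto x^t\langle\Delta\rangle$, $\mathbb Z\to\mathcal X$, with image $\mathrm{axis}(x)$, is a quasi-isometric embedding, and for all $\Lambda\geqslant1$, $K\geqslant0$ there is a Morse constant $M^{(\Lambda,K)}$ such that every (discrete) $(\Lambda,K)$-quasi-geodesic in $\mathcal X$ connecting two points of $\mathrm{axis}(x)$ remains in the $M^{(\Lambda,K)}$-neighbourhood of $\mathrm{axis}(x)$. Let $M_x$ be any Morse constant of $x$ for the pair $(2,0)$, and put $D=(\ell(x)+1)\cdot M_x$. For $h\in G$ let $\lambda(h)=-\max\{k\in\mathbb Z : x\not\preccurlyeq\underline{x^kh}\}$. Then these maxima exist, and the Garside-theoretical projection $\pi\colon\mathcal X\to\mathrm{axis}(x)$, $h\langle\Delta\rangle\mapsto x^{\lambda(h)}\langle\Delta\rangle$, is $5D$-strongly contracting;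 that is: 1. $d_{\mathcal X}(\pi(a),a)\leqslant 5D$ for every $a\in\mathrm{axis}(x)$; 2. $d_{\mathcal X}(v,\pi(v))-d_{\mathcal X}(v,\mathrm{axis}(x))\leqslant 5D$ for every vertex $v$; 3. for all vertices $u,v$, if $d_{\mathcal X}(u,v)<d_{\mathcal X}(v,\mathrm{axis}(x))-5D$ then $d_{\mathcal X}(\pi(u),\pi(v))\leqslant 5D$. -/

import Mathlib

noncomputable section

/-- `x ≼ y`: the element `x` is a prefix of `y`, with respect to the submonoid `P`. -/
def IsPrefix {G : Type*} [Group G] (P : Submonoid G) (x y : G) : Prop := x⁻¹ * y ∈ P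

/-- `x ≽ y`: the element `y` is a suffix of `x`, with respect to the submonoid `P`. -/
def HasSuffix {G : Type*} [Group G] (P : Submonoid G) (x y : G) : Prop := x * y⁻¹ ∈ P

/-- `m` is the greatest common prefix of `x` and `y`. -/
def IsGreatestCommonPrefix {G : Type*} [Group G] (P : Submonoid G) (x y m : G) : Prop :=
  IsPrefix P m x ∧ IsPrefix P m y ∧ ∀ z, IsPrefix P z x → IsPrefix P z y → IsPrefix P z m

/-- `m` is the least common right multiple of `x` and `y`. -/
def IsLeastCommonRightMultiple {G : Type*} [Group G] (P : Submonoid G) (x y m : G) : Prop :=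
  IsPrefix P x m ∧ IsPrefix P y m ∧ ∀ z, IsPrefix P x z → IsPrefix P y z → IsPrefix P m z

/-- `m` is the greatest common suffix of `x` and `y`. -/
def IsGreatestCommonSuffix {G : Type*} [Group G] (P : Submonoid G) (x y m : G) : Prop :=
  HasSuffix P x m ∧ HasSuffix P y m ∧ ∀ z, HasSuffix P x z → HasSuffix P y z → HasSuffix P m z

/-- `m` is the least common left multiple of `x` and `y`. -/
def IsLeastCommonLeftMultiple {G : Type*} [Group G] (P : Submonoid G) (x y m : G) : Prop :=
  HasSuffix P m x ∧ HasSuffix P m y ∧ ∀ z, HasSuffix P z x → HasSuffix P z y → HasSuffix P z m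

/-- A Garside structure `(G⁺, Δ)` on a group `G`. -/
structure GarsideStructure (G : Type*) [Group G] where
  /-- the monoid `G⁺` of positive elements -/
  pos : Submonoid G
  /-- the Garside element `Δ` -/
  delta : G
  eq_one_of_inv_mem : ∀ x ∈ pos, x⁻¹ ∈ pos → x = 1
  delta_mem : delta ∈ pos
  exists_gcp : ∀ x y, ∃ m, IsGreatestCommonPrefix pos x y m
  exists_lcrm : ∀ x y, ∃ m, IsLeastCommonRightMultiple pos x y m
  exists_gcs : ∀ x y, ∃ m, IsGreatestCommonSuffix pos x y m
  exists_lclm : ∀ x y, ∃ m, IsLeastCommonLeftMultiple pos x y m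
  /-- the positive prefixes of `Δ` are the positive suffixes of `Δ` -/
  prefix_iff_suffix : ∀ x ∈ pos, (IsPrefix pos x delta ↔ HasSuffix pos delta x)
  closure_monoid : Submonoid.closure {x | x ∈ pos ∧ IsPrefix pos x delta} = pos
  closure_group : Subgroup.closure {x | x ∈ pos ∧ IsPrefix pos x delta} = ⊤
  /-- the number of factors in a factorization into nontrivial positive elements is bounded -/
  length_bounded : ∀ x ∈ pos, x ≠ 1 → ∃ N : ℕ, ∀ L : List G,
    (∀ a ∈ L, a ∈ pos ∧ a ≠ 1) → L.prod = x → L.length ≤ N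

namespace GarsideStructure

variable {G : Type*} [Group G] (S : GarsideStructure G)

/-- The set `𝒟` of simple elements. -/
def simples : Set G := {x | x ∈ S.pos ∧ IsPrefix S.pos x S.delta}

/-- Proper simple elements: simple elements other than `1` and `Δ`. -/
def IsProperSimple (s : G) : Prop := s ∈ S.simples ∧ s ≠ 1 ∧ s ≠ S.delta

/-- Finite type: there are finitely many simple elements. -/
def IsFiniteType : Prop := S.simples.Finite

/-- Atoms: nontrivial positive elements that are not a product of two nontrivial
positive elements. -/
def IsAtom (a : G) : Prop :=
  a ∈ S.pos ∧ a ≠ 1 ∧ ∀ b ∈ S.pos, ∀ c ∈ S.pos, a = b * c → b = 1 ∨ c = 1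

/-- `m` is the local Garside element `Δ_a`: the least common right multiple of all the elements
`b \ a` with `b` positive, where `b \ a` is defined by `b (b \ a) = b ∨ a`. -/
def IsLocalDelta (a m : G) : Prop :=
  (∀ b ∈ S.pos, ∀ c, IsLeastCommonRightMultiple S.pos b a (b * c) → IsPrefix S.pos c m) ∧
  ∀ z, (∀ b ∈ S.pos, ∀ c, IsLeastCommonRightMultiple S.pos b a (b * c) → IsPrefix S.pos c z) →
    IsPrefix S.pos m z

/-- `Δ`-purity (Picantin): `Δ_a = Δ_b` for all atoms `a` and `b`. -/
def IsDeltaPure : Prop :=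
  ∀ a b, S.IsAtom a → S.IsAtom b → ∃ m, S.IsLocalDelta a m ∧ S.IsLocalDelta b m

/-- The infimum `inf(g) = max {r | Δ^r ≼ g}`. -/
def inf (g : G) : ℤ := sSup {r : ℤ | IsPrefix S.pos (S.delta ^ r) g}

/-- The supremum `sup(g) = min {s | g ≼ Δ^s}`. -/
def sup (g : G) : ℤ := sInf {s : ℤ | IsPrefix S.pos g (S.delta ^ s)}

/-- The canonical length `ℓ(g) = sup(g) - inf(g)`. -/
def canonicalLength (g : G) : ℤ := S.sup g - S.inf g

/-- The left-complement `∂⁻¹(s) = Δ s⁻¹`. -/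
def leftComplement (s : G) : G := S.delta * s⁻¹

/-- `τ^p(g) = Δ^{-p} g Δ^p`. -/
def tauPow (p : ℤ) (g : G) : G := S.delta ^ (-p) * g * S.delta ^ p

/-- The pair `(s, t)` is right-weighted: `∂⁻¹(t)` and `s` have trivial greatest common suffix. -/
def IsRightWeighted (s t : G) : Prop :=
  IsGreatestCommonSuffix S.pos (S.leftComplement t) s 1

/-- `L = [x_r, …, x_1]` are the factors of the right normal form `g = x_r ⋯ x_1 Δ^{inf(g)}`. -/
def IsRightNormalForm (g : G) (L : List G) : Prop :=
  (∀ s ∈ L, S.IsProperSimple s) ∧ L.IsChain S.IsRightWeighted ∧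
    g = L.prod * S.delta ^ S.inf g

/-- Right-rigidity: if `x = x_r ⋯ x_1 Δ^p` is the right normal form, then `τ^p(x_1)` and
`∂⁻¹(x_r)` have trivial greatest common suffix. -/
def IsRightRigid (x : G) : Prop :=
  ∃ (L : List G) (hL : L ≠ []), S.IsRightNormalForm x L ∧
    IsGreatestCommonSuffix S.pos (S.tauPow (S.inf x) (L.getLast hL))
      (S.leftComplement (L.head hL)) 1

/-- The distinguished representative `g Δ^{-inf(g)}` of the coset `g⟨Δ⟩`. -/
def rep (g : G) : G := g * S.delta ^ (-S.inf g)

/-- The vertices of `𝒳`: the left cosets `g⟨Δ⟩`. -/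
def Vertex (S : GarsideStructure G) : Type _ := G ⧸ Subgroup.zpowers S.delta

/-- The vertex `g⟨Δ⟩`. -/
def vertex (g : G) : S.Vertex := (QuotientGroup.mk g : G ⧸ Subgroup.zpowers S.delta)

/-- The graph `𝒳`: the vertices `g⟨Δ⟩` and `h⟨Δ⟩` are joined by an edge if there is a proper
simple element `s` with `rep g * s ∈ h⟨Δ⟩`. -/
def graph : SimpleGraph S.Vertex :=
  SimpleGraph.fromRel fun u v =>
    ∃ g s : G, S.IsProperSimple s ∧ S.vertex g = u ∧ S.vertex (S.rep g * s) = v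

/-! Facts that make the definitions below well posed. -/

theorem vertex_surjective (v : S.Vertex) : ∃ g, S.vertex g = v :=
  QuotientGroup.mk_surjective v

theorem vertex_eq_iff {g h : G} : S.vertex g = S.vertex h ↔ ∃ t : ℤ, h = g * S.delta ^ t := by
  unfold vertex
  refine Iff.trans QuotientGroup.eq ?_
  rw [Subgroup.mem_zpowers_iff]
  constructor
  · rintro ⟨t, ht⟩; exact ⟨t, by rw [ht]; group⟩
  · rintro ⟨t, ht⟩; exact ⟨t, by rw [ht]; group⟩

theorem tau_mem {x : G} (hx : x ∈ S.pos) :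
    S.delta⁻¹ * x * S.delta ∈ S.pos ∧ S.delta * x * S.delta⁻¹ ∈ S.pos := by
  rw [← S.closure_monoid] at hx
  induction hx using Submonoid.closure_induction with
  | mem x hx =>
    obtain ⟨hx, hp⟩ := hx
    have hs := (S.prefix_iff_suffix x hx).1 hp
    constructor
    · have h := (S.prefix_iff_suffix (x⁻¹ * S.delta) hp).2
        (by unfold HasSuffix; simpa [mul_assoc] using hx)
      unfold IsPrefix at h
      simpa [mul_assoc] using h
    · have h := (S.prefix_iff_suffix (S.delta * x⁻¹) hs).1
        (by unfold IsPrefix; simpa [mul_assoc] using hx)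
      unfold HasSuffix at h
      simpa [mul_assoc] using h
  | one => simp [S.pos.one_mem]
  | mul a b _ _ ha hb =>
    constructor
    · have := S.pos.mul_mem ha.1 hb.1
      simpa [mul_assoc] using this
    · have := S.pos.mul_mem ha.2 hb.2
      simpa [mul_assoc] using this

theorem conj_mem (p : ℤ) {x : G} (hx : x ∈ S.pos) :
    S.delta ^ p * x * S.delta ^ (-p) ∈ S.pos := by
  induction p using Int.induction_on with
  | zero => simpa using hx
  | succ i ih =>
    have := (S.tau_mem ih).2
    convert this using 1
    group
  | pred i ih =>
    have := (S.tau_mem ih).1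
    convert this using 1
    group

theorem conj_properSimple (p : ℤ) {s : G} (hs : S.IsProperSimple s) :
    S.IsProperSimple (S.delta ^ p * s * S.delta ^ (-p)) := by
  obtain ⟨⟨h1, h2⟩, h3, h4⟩ := hs
  refine ⟨⟨S.conj_mem p h1, ?_⟩, ?_, ?_⟩
  · have := S.conj_mem p h2
    unfold IsPrefix
    convert this using 1
    group
  · intro h
    apply h3
    have : s = S.delta ^ (-p) * (S.delta ^ p * s * S.delta ^ (-p)) * S.delta ^ p := by group
    rw [this, h]; group
  · intro h
    apply h4
    have : s = S.delta ^ (-p) * (S.delta ^ p * s * S.delta ^ (-p)) * S.delta ^ p := by group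
    rw [this, h]; group

theorem reachable_mul (h : G) (g : G) : S.graph.Reachable (S.vertex g) (S.vertex (g * h)) := by
  have hh : h ∈ Subgroup.closure {x | x ∈ S.pos ∧ IsPrefix S.pos x S.delta} := by
    rw [S.closure_group]; trivial
  induction hh using Subgroup.closure_induction generalizing g with
  | mem s hs =>
    by_cases heq : S.vertex g = S.vertex (g * s)
    · rw [← heq]
    · apply SimpleGraph.Adj.reachable
      rw [graph, SimpleGraph.fromRel_adj]
      refine ⟨heq, Or.inl ⟨g, S.delta ^ (S.inf g) * s * S.delta ^ (-S.inf g), ?_, rfl, ?_⟩⟩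
      · apply S.conj_properSimple
        refine ⟨hs, ?_, ?_⟩
        · rintro rfl; simp at heq
        · intro h
          apply heq
          rw [S.vertex_eq_iff]
          exact ⟨1, by rw [h]; group⟩
      · rw [S.vertex_eq_iff]
        exact ⟨S.inf g, by unfold rep; group⟩
  | one => simp
  | mul a b _ _ ha hb =>
    have := (ha g).trans (hb (g * a))
    rwa [mul_assoc] at this
  | inv a _ ha =>
    have := (ha (g * a⁻¹)).symm
    simpa using this

theorem graph_connected : S.graph.Connected := by
  have : Nonempty S.Vertex := ⟨S.vertex 1⟩
  refine ⟨fun u v => ?_⟩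
  obtain ⟨g, rfl⟩ := S.vertex_surjective u
  obtain ⟨h, rfl⟩ := S.vertex_surjective v
  have := S.reachable_mul (g⁻¹ * h) g
  simpa using this

/-- The graph metric `d_𝒳` on the set of vertices of `𝒳`. -/
instance : MetricSpace S.Vertex where
  dist u v := (S.graph.dist u v : ℝ)
  dist_self u := by simp
  dist_comm u v := by rw [SimpleGraph.dist_comm]
  dist_triangle u v w := by exact_mod_cast S.graph_connected.dist_triangle
  eq_of_dist_eq_zero {u v} h := by
    have h' : S.graph.dist u v = 0 := by exact_mod_cast h
    exact (S.graph_connected.dist_eq_zero_iff).1 h'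

theorem delta_zpow_mem {n : ℤ} (hn : 0 ≤ n) : S.delta ^ n ∈ S.pos := by
  lift n to ℕ using hn
  simpa using S.pos.pow_mem S.delta_mem n

theorem exists_bounds (g : G) : ∃ r s : ℤ,
    IsPrefix S.pos (S.delta ^ r) g ∧ IsPrefix S.pos g (S.delta ^ s) := by
  have hg : g ∈ Subgroup.closure {x | x ∈ S.pos ∧ IsPrefix S.pos x S.delta} := by
    rw [S.closure_group]; trivial
  unfold IsPrefix
  induction hg using Subgroup.closure_induction with
  | mem s hs => exact ⟨0, 1, by simpa using hs.1, by simpa [IsPrefix] using hs.2⟩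
  | one => exact ⟨0, 0, by simp [S.pos.one_mem], by simp [S.pos.one_mem]⟩
  | mul a b _ _ ha hb =>
    obtain ⟨r, s, h1, h2⟩ := ha
    obtain ⟨r', s', h3, h4⟩ := hb
    refine ⟨r + r', s + s', ?_, ?_⟩
    · have := S.pos.mul_mem (S.conj_mem (-r') h1) h3
      convert this using 1
      group
    · have := S.pos.mul_mem h4 (S.conj_mem (-s') h2)
      convert this using 1
      group
  | inv a _ ha =>
    obtain ⟨r, s, h1, h2⟩ := ha
    refine ⟨-s, -r, ?_, ?_⟩
    · have := S.conj_mem s h2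
      convert this using 1
      group
    · have := S.conj_mem r h1
      convert this using 1
      group

theorem isGreatest_inf (hΔ : S.delta ≠ 1) (g : G) :
    IsGreatest {r : ℤ | IsPrefix S.pos (S.delta ^ r) g} (S.inf g) := by
  obtain ⟨r₀, s₀, h1, h2⟩ := S.exists_bounds g
  have hbdd : BddAbove {r : ℤ | IsPrefix S.pos (S.delta ^ r) g} := by
    refine ⟨s₀, fun r hr => ?_⟩
    by_contra! hlt
    apply hΔ
    apply S.eq_one_of_inv_mem _ S.delta_mem
    have h3 := S.pos.mul_mem (S.pos.mul_mem hr h2)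
      (S.delta_zpow_mem (n := r - s₀ - 1) (by omega))
    convert h3 using 1
    group
  exact ⟨Int.csSup_mem ⟨r₀, h1⟩ hbdd, fun r hr => le_csSup hbdd hr⟩

theorem rep_mul_zpow (g : G) (t : ℤ) : S.rep (g * S.delta ^ t) = S.rep g := by
  by_cases hΔ : S.delta = 1
  · simp [rep, hΔ]
  have key : S.inf (g * S.delta ^ t) = S.inf g + t := by
    refine (S.isGreatest_inf hΔ _).unique ⟨?_, fun r hr => ?_⟩
    · have := S.conj_mem (-t) (S.isGreatest_inf hΔ g).1
      change _ ∈ S.pos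
      convert this using 1
      group
    · have h2 : r - t ≤ S.inf g := by
        apply (S.isGreatest_inf hΔ g).2
        have := S.conj_mem t hr
        change _ ∈ S.pos
        convert this using 1
        group
      omega
  unfold rep
  rw [key]
  group

/-- The integer `λ(h) = -max {k | x ⋠ rep (x^k h)}`. -/
def lambda (x h : G) : ℤ :=
  -sSup {k : ℤ | ¬ IsPrefix S.pos x (S.rep (x ^ k * h))}

theorem lambda_mul_zpow (x h : G) (t : ℤ) : S.lambda x (h * S.delta ^ t) = S.lambda x h := by
  unfold lambda
  simp only [← mul_assoc, S.rep_mul_zpow]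

/-- The Garside-theoretical projection `π : h⟨Δ⟩ ↦ x^{λ(h)}⟨Δ⟩`. -/
def proj (x : G) : S.Vertex → S.Vertex :=
  Quotient.lift (fun h : G => S.vertex (x ^ S.lambda x h)) (by
    intro a b hab
    obtain ⟨t, rfl⟩ := S.vertex_eq_iff.1 (Quotient.sound hab)
    simp only [S.lambda_mul_zpow])

theorem proj_vertex (x h : G) : S.proj x (S.vertex h) = S.vertex (x ^ S.lambda x h) := rfl

/-- The parametrized axis `t ↦ x^t⟨Δ⟩` of `x` in `𝒳`; the axis of `x` is its range. -/
def axisMap (x : G) : ℤ → S.Vertex := fun t => S.vertex (x ^ t)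

/-- The axis of `x` in `𝒳`. -/
def axis (x : G) : Set S.Vertex := Set.range (S.axisMap x)

end GarsideStructure

section MorseAndContraction

variable {X : Type*} [MetricSpace X]

/-- `γ : ℤ → X` is a quasi-isometric embedding. -/
def IsQuasiIsometricEmbedding (γ : ℤ → X) : Prop :=
  ∃ A B : ℝ, 1 ≤ A ∧ 0 ≤ B ∧ ∀ s t : ℤ,
    |(s : ℝ) - t| / A - B ≤ dist (γ s) (γ t) ∧ dist (γ s) (γ t) ≤ A * |(s : ℝ) - t| + B

/-- The sequence `c 0, …, c n` is a (discrete) `(Λ, K)`-quasi-geodesic. -/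
def IsQuasiGeodesic (Λ K : ℝ) (n : ℕ) (c : ℕ → X) : Prop :=
  ∀ s t : ℕ, s ≤ n → t ≤ n →
    |(s : ℝ) - t| / Λ - K ≤ dist (c s) (c t) ∧ dist (c s) (c t) ≤ Λ * |(s : ℝ) - t| + K

/-- `M` is a Morse constant of `γ` for the pair `(Λ, K)`: every `(Λ, K)`-quasi-geodesic
connecting two points of the image of `γ` remains in the `M`-neighbourhood of that image. -/
def IsMorseConstant (γ : ℤ → X) (Λ K M : ℝ) : Prop :=
  ∀ (n : ℕ) (c : ℕ → X), IsQuasiGeodesic Λ K n c →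
    c 0 ∈ Set.range γ → c n ∈ Set.range γ →
    ∀ i ≤ n, Metric.infDist (c i) (Set.range γ) ≤ M

/-- The map `γ : ℤ → X` is Morse. -/
def IsMorse (γ : ℤ → X) : Prop :=
  IsQuasiIsometricEmbedding γ ∧
    ∀ Λ K : ℝ, 1 ≤ Λ → 0 ≤ K → ∃ M : ℝ, IsMorseConstant γ Λ K M

/-- The map `ρ : X → A` is `C`-strongly contracting. -/
def IsStronglyContracting (C : ℝ) (A : Set X) (ρ : X → X) : Prop :=
  0 ≤ C ∧ (∀ v, ρ v ∈ A) ∧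
  (∀ a ∈ A, dist (ρ a) a ≤ C) ∧
  (∀ v, dist v (ρ v) - Metric.infDist v A ≤ C) ∧
  (∀ u v, dist u v < Metric.infDist v A - C → dist (ρ u) (ρ v) ≤ C)

end MorseAndContraction

/-- Morse elements of a Garside group: the axis in `𝒳` is Morse. -/
def GarsideStructure.IsMorseElement {G : Type*} [Group G] (S : GarsideStructure G) (x : G) :
    Prop :=
  IsMorse (S.axisMap x)

end

/-!
Put `r = ℓ(x)` and `D = (r + 1) * M`. The distance between `g⟨Δ⟩` and `h⟨Δ⟩` in `𝒳` is the
canonical length `ℓ(g⁻¹ h)` (`dist_vertex`), and if `a`, `b` are positive, free of `Δ`, with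
greatest common prefix `m`, it is at least `sup (m⁻¹ a) + sup (m⁻¹ b)` (`sup_add_sup_le_length`).
So everything amounts to showing that certain common prefixes are short.

Rigidity enters through right normal forms: the normal form of `x^k` is a concatenation of copies of
that of `x`. Therefore the powers of `x` are free of `Δ`, `sup (x^k) = k * r`, and a prefix of
`x^(k+1)` that does not begin with `x` has a complement of supremum greater than `k * r`
(`HasRigidPowers`). Every vertex is a translate `x^n b⟨Δ⟩` where `b` is positive, does not begin
with `x`, and no `x^k b` with `k ≥ 0` is divisible by `Δ` (`ProjectsToOne`); then `n = λ(h)`. This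
proves that the maxima exist. An element `b` of this kind that is at distance at most `M` from the
axis satisfies `sup b ≤ D` (`sup_le_of_near_axis`), which is where the constant `D` comes from.

The Morse property is used for two `(2, 0)`-quasi-geodesics.

* If `d ≼ x^k` does not begin with `x`, the concatenation of geodesics from `1` to `d` and from `d`
  to `x^k` is one, because a product of consecutive pieces is positive, free of `Δ`, and at least as
  long as either piece. Hence `sup d ≤ D` (`sup_le_of_prefix_pow`).
* If `e` projects to `1` and `sup (x^k e) = k * r`, the concatenation of geodesics from `1` to `x^k e`
  and from there back to `x^k` is one. Hence `sup e ≤ D` (`sup_le_of_sup_pow_mul_le`).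

The first fact shows that `b` is almost as far from each `x^j` as from `1`, which gives the second
clause of contraction. For the third, suppose that `a` and `x^k b` have distant projections `1` and
`x^k`, and let `m` be their greatest common prefix, which does not begin with `x`. The greatest
common prefix of `x^k b` with `Δ^(k * r)` is within `D` of `x^k` by the second fact, and a prefix of
it that does not begin with `x` diverges from the axis by the first fact. Comparing the two gives
`sup m ≤ 3 D`, so that `a` and `x^k b` are at least as far apart as either is from the axis,
up to `3 D`.
-/

namespace GarsideStructure

variable {G : Type*} [Group G] (S : GarsideStructure G)

/-! ### The prefix order -/

theorem prefix_refl (a : G) : IsPrefix S.pos a a := by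
  simp [IsPrefix, S.pos.one_mem]

variable {S} in
theorem prefix_trans {a b c : G} (hab : IsPrefix S.pos a b) (hbc : IsPrefix S.pos b c) :
    IsPrefix S.pos a c := by
  have := S.pos.mul_mem hab hbc
  unfold IsPrefix
  convert this using 1
  group

theorem prefix_mul_left_iff (g : G) {a b : G} :
    IsPrefix S.pos (g * a) (g * b) ↔ IsPrefix S.pos a b := by
  unfold IsPrefix
  rw [show (g * a)⁻¹ * (g * b) = a⁻¹ * b by group]

theorem prefix_mul_right (a : G) {c : G} (hc : c ∈ S.pos) : IsPrefix S.pos a (a * c) := by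
  simpa [IsPrefix] using hc

theorem one_prefix_iff {a : G} : IsPrefix S.pos 1 a ↔ a ∈ S.pos := by
  simp [IsPrefix]

variable {S} in
theorem mem_of_prefix {a b : G} (ha : a ∈ S.pos) (hab : IsPrefix S.pos a b) : b ∈ S.pos :=
  S.one_prefix_iff.1 (prefix_trans (S.one_prefix_iff.2 ha) hab)

/-- Right multiplication by a power of `Δ` respects the prefix order, since `Δ` normalizes the
positive monoid. -/
theorem prefix_mul_zpow {a b : G} (h : IsPrefix S.pos a b) (k : ℤ) :
    IsPrefix S.pos (a * S.delta ^ k) (b * S.delta ^ k) := by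
  have := S.conj_mem (-k) h
  unfold IsPrefix
  convert this using 1
  group

theorem prefix_mul_zpow_of_nonneg (a : G) {k : ℤ} (hk : 0 ≤ k) :
    IsPrefix S.pos a (a * S.delta ^ k) :=
  S.prefix_mul_right a (S.delta_zpow_mem hk)

theorem zpow_prefix_zpow {k l : ℤ} (h : k ≤ l) :
    IsPrefix S.pos (S.delta ^ k) (S.delta ^ l) := by
  have := S.prefix_mul_zpow_of_nonneg (S.delta ^ k) (k := l - k) (by omega)
  rwa [← zpow_add, add_sub_cancel] at this

variable {S} in
/-- `Δ` is a prefix of a product as soon as it is a prefix of the right factor. -/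
theorem delta_prefix_mul {c a : G} (hc : c ∈ S.pos) (h : IsPrefix S.pos S.delta a) :
    IsPrefix S.pos S.delta (c * a) := by
  have := S.pos.mul_mem (S.conj_mem (-1) hc) h
  unfold IsPrefix
  convert this using 1
  group

/-! ### Infimum, supremum and canonical length -/

variable {S}

theorem le_inf_iff (hΔ : S.delta ≠ 1) {g : G} {r : ℤ} :
    r ≤ S.inf g ↔ IsPrefix S.pos (S.delta ^ r) g :=
  ⟨fun h => prefix_trans (S.zpow_prefix_zpow h) (S.isGreatest_inf hΔ g).1,
    fun h => (S.isGreatest_inf hΔ g).2 h⟩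

theorem prefix_zpow_iff {g : G} {s : ℤ} :
    IsPrefix S.pos g (S.delta ^ s) ↔ IsPrefix S.pos (S.delta ^ (-s)) g⁻¹ := by
  constructor <;> intro h
  · have := S.conj_mem s h
    unfold IsPrefix
    convert this using 1
    group
  · have := S.conj_mem (-s) h
    unfold IsPrefix
    convert this using 1
    group

theorem sup_eq_neg_inf (hΔ : S.delta ≠ 1) (g : G) : S.sup g = -S.inf g⁻¹ := by
  have : IsLeast {s : ℤ | IsPrefix S.pos g (S.delta ^ s)} (-S.inf g⁻¹) := by
    refine ⟨?_, fun s hs => ?_⟩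
    · rw [Set.mem_ofPred_eq, prefix_zpow_iff, neg_neg]
      exact (S.isGreatest_inf hΔ _).1
    · have := (le_inf_iff hΔ).2 (prefix_zpow_iff.1 hs)
      omega
  exact this.csInf_eq

theorem sup_le_iff (hΔ : S.delta ≠ 1) {g : G} {s : ℤ} :
    S.sup g ≤ s ↔ IsPrefix S.pos g (S.delta ^ s) := by
  rw [sup_eq_neg_inf hΔ, prefix_zpow_iff, ← le_inf_iff hΔ]
  omega

theorem prefix_sup (hΔ : S.delta ≠ 1) (g : G) : IsPrefix S.pos g (S.delta ^ S.sup g) :=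
  (sup_le_iff hΔ).1 le_rfl

theorem sup_mul_le (hΔ : S.delta ≠ 1) (g h : G) : S.sup (g * h) ≤ S.sup g + S.sup h := by
  rw [sup_le_iff hΔ, zpow_add]
  exact prefix_trans ((S.prefix_mul_left_iff g).2 (prefix_sup hΔ h))
    (S.prefix_mul_zpow (prefix_sup hΔ g) _)

theorem le_inf_mul (hΔ : S.delta ≠ 1) (g h : G) : S.inf g + S.inf h ≤ S.inf (g * h) := by
  have := sup_mul_le hΔ h⁻¹ g⁻¹
  rw [sup_eq_neg_inf hΔ, sup_eq_neg_inf hΔ, sup_eq_neg_inf hΔ] at this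
  simp only [mul_inv_rev, inv_inv] at this
  omega

theorem inf_mul_le (hΔ : S.delta ≠ 1) (g h : G) : S.inf (g * h) ≤ S.inf g + S.sup h := by
  have := le_inf_mul hΔ (g * h) h⁻¹
  rw [mul_inv_cancel_right] at this
  rw [sup_eq_neg_inf hΔ]
  omega

theorem inf_nonneg_iff (hΔ : S.delta ≠ 1) {g : G} : 0 ≤ S.inf g ↔ g ∈ S.pos := by
  rw [le_inf_iff hΔ, zpow_zero, one_prefix_iff]

theorem inf_eq_zero_iff (hΔ : S.delta ≠ 1) {g : G} :
    S.inf g = 0 ↔ g ∈ S.pos ∧ ¬ IsPrefix S.pos S.delta g := by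
  rw [← inf_nonneg_iff hΔ]
  have := le_inf_iff hΔ (g := g) (r := 1)
  rw [zpow_one] at this
  rw [← this]
  omega

theorem inf_one (hΔ : S.delta ≠ 1) : S.inf (1 : G) = 0 := by
  refine (inf_eq_zero_iff hΔ).2 ⟨S.pos.one_mem, fun h => hΔ ?_⟩
  exact S.eq_one_of_inv_mem _ S.delta_mem (by simpa [IsPrefix] using h)

theorem sup_one (hΔ : S.delta ≠ 1) : S.sup (1 : G) = 0 := by
  rw [sup_eq_neg_inf hΔ, inv_one, inf_one hΔ, neg_zero]

theorem sup_mono (hΔ : S.delta ≠ 1) {g h : G} (hgh : IsPrefix S.pos g h) :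
    S.sup g ≤ S.sup h :=
  (sup_le_iff hΔ).2 (prefix_trans hgh (prefix_sup hΔ h))

theorem sup_nonneg (hΔ : S.delta ≠ 1) {g : G} (hg : g ∈ S.pos) : 0 ≤ S.sup g := by
  rw [← sup_one hΔ]
  exact sup_mono hΔ (S.one_prefix_iff.2 hg)

theorem sup_le_sup_mul_left (hΔ : S.delta ≠ 1) {c : G} (hc : c ∈ S.pos) (g : G) :
    S.sup g ≤ S.sup (c * g) := by
  have h := sup_mul_le hΔ c⁻¹ (c * g)
  have h2 : S.sup c⁻¹ ≤ 0 := by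
    rw [sup_eq_neg_inf hΔ, inv_inv, neg_nonpos]
    exact (inf_nonneg_iff hΔ).2 hc
  rw [inv_mul_cancel_left] at h
  omega

theorem sup_le_sup_mul_right (hΔ : S.delta ≠ 1) {c : G} (hc : c ∈ S.pos) (g : G) :
    S.sup g ≤ S.sup (g * c) :=
  sup_mono hΔ (S.prefix_mul_right g hc)

/-- A positive element of supremum `0` is trivial. -/
theorem eq_one_of_sup_le_zero (hΔ : S.delta ≠ 1) {g : G} (hg : g ∈ S.pos) (h : S.sup g ≤ 0) :
    g = 1 := by
  rw [sup_le_iff hΔ, zpow_zero] at h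
  exact S.eq_one_of_inv_mem g hg (by simpa [IsPrefix] using h)

theorem canonicalLength_mul_le (hΔ : S.delta ≠ 1) (g h : G) :
    S.canonicalLength (g * h) ≤ S.canonicalLength g + S.canonicalLength h := by
  have h1 := sup_mul_le hΔ g h
  have h2 := le_inf_mul hΔ g h
  unfold canonicalLength
  omega

theorem canonicalLength_inv (hΔ : S.delta ≠ 1) (g : G) :
    S.canonicalLength g⁻¹ = S.canonicalLength g := by
  unfold canonicalLength
  rw [sup_eq_neg_inf hΔ g⁻¹, sup_eq_neg_inf hΔ g, inv_inv]
  omega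

theorem canonicalLength_delta_zpow (hΔ : S.delta ≠ 1) (k : ℤ) :
    S.canonicalLength (S.delta ^ k) ≤ 0 := by
  have h1 : S.sup (S.delta ^ k) ≤ k := (sup_le_iff hΔ).2 (S.prefix_refl _)
  have h2 : k ≤ S.inf (S.delta ^ k) := (le_inf_iff hΔ).2 (S.prefix_refl _)
  unfold canonicalLength
  omega

theorem canonicalLength_le_sup (hΔ : S.delta ≠ 1) {g : G} (hg : g ∈ S.pos) :
    S.canonicalLength g ≤ S.sup g := by
  have := (inf_nonneg_iff hΔ).2 hg
  unfold canonicalLength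
  omega

theorem sup_le_canonicalLength (hΔ : S.delta ≠ 1) {g : G}
    (hg : ¬ IsPrefix S.pos S.delta g) : S.sup g ≤ S.canonicalLength g := by
  have := le_inf_iff hΔ (g := g) (r := 1)
  rw [zpow_one] at this
  rw [← this] at hg
  unfold canonicalLength
  omega

/-! ### Geodesics and the graph metric -/

/-- The initial segments `a ∧ Δ^i` of the left greedy decomposition of a positive element `a`
form a geodesic from `1` to `a`, increasing for the prefix order. -/
theorem exists_geodesic (hΔ : S.delta ≠ 1) {a : G} (ha : a ∈ S.pos) {n : ℕ}
    (hn : S.sup a = n) :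
    ∃ c : ℕ → G, c 0 = 1 ∧ c n = a ∧ ∀ i j, i ≤ j → j ≤ n →
      IsPrefix S.pos (c i) (c j) ∧ S.sup ((c i)⁻¹ * c j) = (j : ℤ) - i := by
  choose c hc using fun i : ℕ => S.exists_gcp a (S.delta ^ (i : ℤ))
  have hcpos (i : ℕ) : c i ∈ S.pos := by
    rw [← one_prefix_iff]
    exact (hc i).2.2 1 (S.one_prefix_iff.2 ha) (S.one_prefix_iff.2 (S.delta_zpow_mem (by omega)))
  have hmono (i j : ℕ) (hij : i ≤ j) : IsPrefix S.pos (c i) (c j) :=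
    (hc j).2.2 _ (hc i).1 (prefix_trans (hc i).2.1 (S.zpow_prefix_zpow (by omega)))
  have hstep (i j : ℕ) (hij : i ≤ j) : S.sup ((c i)⁻¹ * c j) ≤ (j : ℤ) - i := by
    rw [sup_le_iff hΔ, ← S.prefix_mul_left_iff (c i), mul_inv_cancel_left]
    -- `c i * Δ^(j - i)` is the greatest common prefix of `a * Δ^(j - i)` and `Δ^j`.
    have key := (hc i).2.2 (c j * S.delta ^ (-((j : ℤ) - i)))
      (prefix_trans (S.prefix_mul_zpow (hc j).1 _) (by
        have := S.prefix_mul_zpow_of_nonneg (a * S.delta ^ (-((j : ℤ) - i)))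
          (k := (j : ℤ) - i) (by omega)
        rwa [mul_assoc, ← zpow_add, neg_add_cancel, zpow_zero, mul_one] at this))
      (by
        have := S.prefix_mul_zpow (hc j).2.1 (-((j : ℤ) - i))
        rwa [← zpow_add, show (j : ℤ) + -((j : ℤ) - i) = i by ring] at this)
    have := S.prefix_mul_zpow key ((j : ℤ) - i)
    rwa [mul_assoc, ← zpow_add, neg_add_cancel, zpow_zero, mul_one] at this
  have h0 : c 0 = 1 := by
    refine eq_one_of_sup_le_zero hΔ (hcpos 0) ((sup_le_iff hΔ).2 ?_)
    simpa using (hc 0).2.1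
  have hnn : c n = a := by
    have h1 : IsPrefix S.pos a (c n) :=
      (hc n).2.2 a (S.prefix_refl a) (by rw [← hn]; exact prefix_sup hΔ a)
    have h2 := S.eq_one_of_inv_mem (a⁻¹ * c n) h1 (by
      have := (hc n).1
      unfold IsPrefix at this
      convert this using 1
      group)
    rw [inv_mul_eq_one] at h2
    exact h2.symm
  refine ⟨c, h0, hnn, fun i j hij hjn => ⟨hmono i j hij, le_antisymm (hstep i j hij) ?_⟩⟩
  have h1 := hstep 0 i (Nat.zero_le i)
  have h2 := hstep j n hjn
  have h3 := sup_mul_le hΔ (c i) ((c i)⁻¹ * c j)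
  have h4 := sup_mul_le hΔ (c j) ((c j)⁻¹ * c n)
  rw [mul_inv_cancel_left] at h3 h4
  rw [h0, inv_one, one_mul] at h1
  rw [hnn, hn] at h4
  rw [hnn] at h2
  push_cast at h1
  omega

theorem sup_simple_le (hΔ : S.delta ≠ 1) {s : G} (hs : IsPrefix S.pos s S.delta) :
    S.sup s ≤ 1 := by
  rw [sup_le_iff hΔ, zpow_one]
  exact hs

theorem graph_adj_length_le (hΔ : S.delta ≠ 1) {g h : G}
    (hadj : S.graph.Adj (S.vertex g) (S.vertex h)) : S.canonicalLength (g⁻¹ * h) ≤ 1 := by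
  have main : ∀ g h g' s : G, S.IsProperSimple s → S.vertex g' = S.vertex g →
      S.vertex (S.rep g' * s) = S.vertex h → S.canonicalLength (g⁻¹ * h) ≤ 1 := by
    intro g h g' s hs h1 h2
    obtain ⟨t, rfl⟩ := S.vertex_eq_iff.1 h1
    obtain ⟨t', rfl⟩ := S.vertex_eq_iff.1 h2
    have e : (g' * S.delta ^ t)⁻¹ * (S.rep g' * s * S.delta ^ t') =
        S.delta ^ (-t - S.inf g') * s * S.delta ^ t' := by
      unfold rep; group
    rw [e]
    have a1 := canonicalLength_mul_le hΔ (S.delta ^ (-t - S.inf g') * s) (S.delta ^ t')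
    have a2 := canonicalLength_mul_le hΔ (S.delta ^ (-t - S.inf g')) s
    have a3 := canonicalLength_delta_zpow hΔ (-t - S.inf g')
    have a4 := canonicalLength_delta_zpow hΔ t'
    have a5 := canonicalLength_le_sup hΔ hs.1.1
    have a6 := sup_simple_le hΔ hs.1.2
    omega
  rw [graph, SimpleGraph.fromRel_adj] at hadj
  rcases hadj.2 with ⟨g', s, hs, h1, h2⟩ | ⟨g', s, hs, h1, h2⟩
  · exact main g h g' s hs h1 h2
  · have := main h g g' s hs h1 h2
    rwa [← canonicalLength_inv hΔ, mul_inv_rev, inv_inv] at this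

theorem length_le_walk_length (hΔ : S.delta ≠ 1) {u v : S.Vertex} (w : S.graph.Walk u v) :
    ∀ g h : G, S.vertex g = u → S.vertex h = v →
      S.canonicalLength (g⁻¹ * h) ≤ w.length := by
  induction w with
  | nil =>
    intro g h hg hh
    obtain ⟨t, rfl⟩ := S.vertex_eq_iff.1 (hg.trans hh.symm)
    simpa using canonicalLength_delta_zpow hΔ t
  | cons hadj w ih =>
    intro g h hg hh
    rename_i u v' _
    obtain ⟨k, hk⟩ := S.vertex_surjective v'
    have h1 := ih k h hk hh
    rw [← hg, ← hk] at hadj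
    have h2 := graph_adj_length_le hΔ hadj
    have h3 := canonicalLength_mul_le hΔ (g⁻¹ * k) (k⁻¹ * h)
    rw [show g⁻¹ * k * (k⁻¹ * h) = g⁻¹ * h by group] at h3
    rw [SimpleGraph.Walk.length_cons]
    push_cast
    omega

theorem graph_dist_mul_simple_le (g : G) {s : G} (hs : s ∈ S.simples) :
    S.graph.dist (S.vertex g) (S.vertex (g * s)) ≤ 1 := by
  by_cases heq : S.vertex g = S.vertex (g * s)
  · rw [← heq, SimpleGraph.dist_self]
    exact Nat.zero_le 1
  · refine le_of_eq (SimpleGraph.dist_eq_one_iff_adj.2 ?_)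
    rw [graph, SimpleGraph.fromRel_adj]
    refine ⟨heq, Or.inl ⟨g, S.delta ^ (S.inf g) * s * S.delta ^ (-S.inf g), ?_, rfl, ?_⟩⟩
    · refine S.conj_properSimple _ ⟨hs, ?_, ?_⟩
      · rintro rfl; simp at heq
      · intro h
        exact heq (S.vertex_eq_iff.2 ⟨1, by rw [h]; group⟩)
    · exact S.vertex_eq_iff.2 ⟨S.inf g, by unfold rep; group⟩

theorem graph_dist_mul_pos_le (hΔ : S.delta ≠ 1) (g : G) {a : G} (ha : a ∈ S.pos) {n : ℕ}
    (hn : S.sup a = n) : S.graph.dist (S.vertex g) (S.vertex (g * a)) ≤ n := by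
  obtain ⟨c, h0, hcn, hc⟩ := exists_geodesic hΔ ha hn
  have key : ∀ i, i ≤ n → S.graph.dist (S.vertex g) (S.vertex (g * c i)) ≤ i := by
    intro i
    induction i with
    | zero => simp [h0]
    | succ i ih =>
      intro hi
      obtain ⟨h1, h2⟩ := hc i (i + 1) (Nat.le_succ i) hi
      have h3 := graph_dist_mul_simple_le (S := S) (g * c i) (s := (c i)⁻¹ * c (i + 1))
        ⟨h1, by
          have : S.sup ((c i)⁻¹ * c (i + 1)) ≤ 1 := by rw [h2]; push_cast; omega
          simpa using (sup_le_iff hΔ).1 this⟩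
      rw [mul_assoc, mul_inv_cancel_left] at h3
      have h4 := S.graph_connected.dist_triangle (u := S.vertex g) (v := S.vertex (g * c i))
        (w := S.vertex (g * c (i + 1)))
      have h5 := ih (by omega)
      omega
  have := key n le_rfl
  rwa [hcn] at this

/-- The graph metric is given by the canonical length. -/
theorem dist_vertex (hΔ : S.delta ≠ 1) (g h : G) :
    dist (S.vertex g) (S.vertex h) = (S.canonicalLength (g⁻¹ * h) : ℝ) := by
  change ((S.graph.dist (S.vertex g) (S.vertex h) : ℕ) : ℝ) = _
  suffices H : (S.graph.dist (S.vertex g) (S.vertex h) : ℤ) = S.canonicalLength (g⁻¹ * h) by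
    rw [← H]; push_cast; rfl
  apply le_antisymm
  · set a := S.rep (g⁻¹ * h) with ha
    have hapos : a ∈ S.pos := by
      have := S.conj_mem (S.inf (g⁻¹ * h)) (S.isGreatest_inf hΔ (g⁻¹ * h)).1
      rw [ha, rep]
      convert this using 1
      group
    have hsup : S.sup a ≤ S.canonicalLength (g⁻¹ * h) := by
      have h1 := sup_mul_le hΔ (g⁻¹ * h) (S.delta ^ (-S.inf (g⁻¹ * h)))
      have h2 : S.sup (S.delta ^ (-S.inf (g⁻¹ * h))) ≤ -S.inf (g⁻¹ * h) :=
        (sup_le_iff hΔ).2 (S.prefix_refl _)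
      rw [ha, rep]
      unfold canonicalLength
      omega
    obtain ⟨n, hn⟩ := Int.eq_ofNat_of_zero_le (sup_nonneg hΔ hapos)
    have h3 := graph_dist_mul_pos_le hΔ g hapos hn
    have h4 : S.vertex (g * a) = S.vertex h :=
      S.vertex_eq_iff.2 ⟨S.inf (g⁻¹ * h), by rw [ha, rep]; group⟩
    rw [h4] at h3
    omega
  · obtain ⟨w, hw⟩ := S.graph_connected.exists_walk_length_eq_dist (S.vertex g) (S.vertex h)
    have := length_le_walk_length hΔ w g h rfl rfl
    rwa [hw] at this

/-- Distances in `𝒳` are bounded below by the lengths of the complements of the greatest common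
prefix. -/
theorem sup_add_sup_le_length (hΔ : S.delta ≠ 1) {a b m : G} (ha : a ∈ S.pos) (hb : b ∈ S.pos)
    (haΔ : ¬ IsPrefix S.pos S.delta a) (hbΔ : ¬ IsPrefix S.pos S.delta b)
    (hm : IsGreatestCommonPrefix S.pos a b m) :
    S.sup (m⁻¹ * a) + S.sup (m⁻¹ * b) ≤ S.canonicalLength (a⁻¹ * b) := by
  have hmpos : m ∈ S.pos :=
    S.one_prefix_iff.1 (hm.2.2 1 (S.one_prefix_iff.2 ha) (S.one_prefix_iff.2 hb))
  have main : ∀ a b : G, ¬ IsPrefix S.pos S.delta b → IsGreatestCommonPrefix S.pos a b m →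
      S.inf (a⁻¹ * b) ≤ -S.sup (m⁻¹ * a) := by
    intro a b hbΔ hm
    have h1 := (S.isGreatest_inf hΔ (a⁻¹ * b)).1
    set k := S.inf (a⁻¹ * b)
    have h2 : IsPrefix S.pos (a * S.delta ^ k) b := by
      have := (S.prefix_mul_left_iff a).2 h1
      rwa [mul_inv_cancel_left] at this
    rcases le_or_gt k 0 with hk | hk
    · have h3 : IsPrefix S.pos (a * S.delta ^ k) a := by
        have := S.prefix_mul_zpow_of_nonneg (a * S.delta ^ k) (k := -k) (by omega)
        rwa [mul_assoc, ← zpow_add, add_neg_cancel, zpow_zero, mul_one] at this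
      have h4 := S.prefix_mul_zpow (hm.2.2 _ h3 h2) (-k)
      rw [mul_assoc, ← zpow_add, add_neg_cancel, zpow_zero, mul_one] at h4
      have h5 : S.sup (m⁻¹ * a) ≤ -k := by
        rw [sup_le_iff hΔ, ← S.prefix_mul_left_iff m, mul_inv_cancel_left]
        exact h4
      omega
    · -- A positive exponent would make `Δ` a prefix of `b`.
      refine absurd ?_ hbΔ
      have h3 : IsPrefix S.pos S.delta (S.delta ^ k) := by
        simpa using S.zpow_prefix_zpow (show (1 : ℤ) ≤ k by omega)
      have h4 : a ∈ S.pos := mem_of_prefix hmpos hm.1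
      exact prefix_trans (delta_prefix_mul h4 h3) h2
  have h1 := main a b hbΔ hm
  have h2 := main b a haΔ ⟨hm.2.1, hm.1, fun z h1 h2 => hm.2.2 z h2 h1⟩
  have h3 := sup_eq_neg_inf hΔ (a⁻¹ * b)
  rw [mul_inv_rev, inv_inv] at h3
  unfold canonicalLength
  omega

/-! ### The suffix order and right normal forms -/

theorem hasSuffix_trans {a b c : G} (hab : HasSuffix S.pos a b) (hbc : HasSuffix S.pos b c) :
    HasSuffix S.pos a c := by
  have := S.pos.mul_mem hab hbc
  unfold HasSuffix
  convert this using 1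
  group

theorem hasSuffix_mul_right_iff {a b : G} (g : G) :
    HasSuffix S.pos (a * g) (b * g) ↔ HasSuffix S.pos a b := by
  unfold HasSuffix
  rw [show a * g * (b * g)⁻¹ = a * b⁻¹ by group]

theorem hasSuffix_mul_left {c : G} (hc : c ∈ S.pos) (a : G) : HasSuffix S.pos (c * a) a := by
  simpa [HasSuffix] using hc

theorem zpow_hasSuffix_iff {z : G} {m : ℤ} :
    HasSuffix S.pos (S.delta ^ m) z ↔ IsPrefix S.pos z (S.delta ^ m) := by
  constructor <;> intro h
  · have := S.conj_mem (-m) h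
    unfold IsPrefix
    convert this using 1
    group
  · have := S.conj_mem m h
    unfold HasSuffix
    convert this using 1
    group

theorem hasSuffix_delta_iff {z : G} :
    HasSuffix S.pos z S.delta ↔ IsPrefix S.pos S.delta z := by
  constructor <;> intro h
  · have := S.conj_mem (-1) h
    unfold IsPrefix
    convert this using 1
    group
  · have := S.conj_mem 1 h
    unfold HasSuffix
    convert this using 1
    group

/-- If `t` is the maximal simple suffix of `s * t`, and `s` is the maximal simple suffix of `a`,
then `t` is the maximal simple suffix of `a * t`. -/
theorem simple_suffix_mul {a s t : G} (ht : HasSuffix S.pos S.delta t) (htpos : t ∈ S.pos)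
    (ha : ∀ z, HasSuffix S.pos S.delta z → HasSuffix S.pos a z → HasSuffix S.pos s z)
    (hst : IsGreatestCommonSuffix S.pos (S.leftComplement t) s 1) (hapos : a ∈ S.pos) {z : G}
    (hz : HasSuffix S.pos S.delta z) (haz : HasSuffix S.pos (a * t) z) :
    HasSuffix S.pos t z := by
  obtain ⟨l, hl1, hl2, hl3⟩ := S.exists_lclm z t
  have e : l * t⁻¹ * t = l := by group
  have h1 : HasSuffix S.pos S.delta (l * t⁻¹ * t) := e.symm ▸ hl3 _ hz ht
  have h2 : HasSuffix S.pos (a * t) (l * t⁻¹ * t) :=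
    e.symm ▸ hl3 _ haz (hasSuffix_mul_left hapos t)
  rw [hasSuffix_mul_right_iff] at h2
  have h3 : HasSuffix S.pos (S.leftComplement t) (l * t⁻¹) := by
    unfold leftComplement
    rw [← hasSuffix_mul_right_iff t]
    rwa [inv_mul_cancel_right]
  -- The complement `l * t⁻¹` of `t` in the least common left multiple is a simple suffix of `a`.
  have h4 : HasSuffix S.pos S.delta (l * t⁻¹) := by
    refine hasSuffix_trans ?_ h3
    unfold leftComplement
    unfold HasSuffix
    have := S.conj_mem 1 htpos
    convert this using 1
    group
  have h5 := hst.2.2 _ h3 (ha _ h4 h2)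
  have h6 : l * t⁻¹ = 1 := S.eq_one_of_inv_mem _ hl2 (by simpa [HasSuffix] using h5)
  rw [mul_inv_eq_one] at h6
  rwa [h6] at hl1

theorem list_prod_mem {L : List G} (hL : ∀ s ∈ L, S.IsProperSimple s) : L.prod ∈ S.pos :=
  S.pos.list_prod_mem fun s hs => (hL s hs).1.1

theorem IsProperSimple.hasSuffix {s : G} (hs : S.IsProperSimple s) :
    HasSuffix S.pos S.delta s :=
  (S.prefix_iff_suffix s hs.1.1).1 hs.1.2

/-- The last factor of a right normal form is its maximal simple suffix. -/
theorem simple_suffix_of_normalForm {t : G} (C : List G)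
    (hC : ∀ s ∈ C ++ [t], S.IsProperSimple s) (hch : (C ++ [t]).IsChain S.IsRightWeighted) {z : G}
    (hz : HasSuffix S.pos S.delta z) (hCz : HasSuffix S.pos (C ++ [t]).prod z) :
    HasSuffix S.pos t z := by
  induction C using List.reverseRecOn generalizing t z with
  | nil => simpa using hCz
  | append_singleton C s ih =>
    have hs : ∀ s' ∈ C ++ [s], S.IsProperSimple s' :=
      fun s' hs' => hC s' (List.mem_append_left _ hs')
    have ht := hC t (by simp)
    rw [List.isChain_append] at hch
    rw [List.prod_append, List.prod_singleton] at hCz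
    exact simple_suffix_mul ht.hasSuffix ht.1.1 (fun z hz hz' => ih hs hch.1 hz hz')
      (hch.2.2 s (by simp) t (by simp)) (list_prod_mem hs) hz hCz

/-- The product of the last `m` factors of a right normal form is its greatest common suffix with
`Δ^m`. -/
theorem zpow_suffix_of_normalForm (A B : List G)
    (hAB : ∀ s ∈ A ++ B, S.IsProperSimple s) (hch : (A ++ B).IsChain S.IsRightWeighted) {z : G}
    (hz : HasSuffix S.pos (S.delta ^ (B.length : ℤ)) z) (hABz : HasSuffix S.pos (A ++ B).prod z) :
    HasSuffix S.pos B.prod z := by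
  induction B using List.reverseRecOn generalizing z with
  | nil => simpa using hz
  | append_singleton B t ih =>
    rw [← List.append_assoc] at hAB hch hABz
    have ht := hAB t (by simp)
    have hs : ∀ s' ∈ A ++ B, S.IsProperSimple s' :=
      fun s' hs' => hAB s' (List.mem_append_left _ hs')
    have hch' := (List.isChain_append.1 hch).1
    set m : ℤ := (B.length : ℤ) with hm
    have hm1 : (((B ++ [t]).length : ℕ) : ℤ) = m + 1 := by simp [hm]
    rw [hm1] at hz
    have htm : HasSuffix S.pos (S.delta ^ (m + 1)) t := by
      refine hasSuffix_trans ?_ ht.hasSuffix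
      unfold HasSuffix
      have := S.delta_zpow_mem (n := m) (by omega)
      convert this using 1
      group
    obtain ⟨l, hl1, hl2, hl3⟩ := S.exists_lclm z t
    have hl4 := hl3 _ hz htm
    have hl5 := hl3 _ hABz (by
      rw [List.prod_append, List.prod_singleton]
      exact hasSuffix_mul_left (list_prod_mem hs) t)
    -- The maximal simple suffix of `l` is `t`, so removing it lowers the supremum of `l`.
    have key : HasSuffix S.pos (S.delta ^ m * t) l := by
      obtain ⟨u, hu1, hu2, hu3⟩ := S.exists_gcs l S.delta
      have hu4 : HasSuffix S.pos t u :=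
        simple_suffix_of_normalForm (A ++ B) hAB hch hu2 (hasSuffix_trans hl5 hu1)
      have hu5 := hu3 (S.delta ^ (-m) * l)
        (by
          have := S.delta_zpow_mem (n := m) (by omega)
          unfold HasSuffix
          convert this using 1
          group)
        (by
          have := S.conj_mem (-m) hl4
          unfold HasSuffix
          convert this using 1
          group)
      have := S.conj_mem m (S.pos.mul_mem hu4 hu5)
      unfold HasSuffix
      convert this using 1
      group
    have e : l * t⁻¹ * t = l := by group
    have h1 : HasSuffix S.pos (S.delta ^ m) (l * t⁻¹) := by
      rwa [← hasSuffix_mul_right_iff t, e]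
    have h2 : HasSuffix S.pos (A ++ B).prod (l * t⁻¹) := by
      rw [← hasSuffix_mul_right_iff t, e]
      rwa [List.prod_append, List.prod_singleton] at hl5
    have h3 := ih hs hch' h1 h2
    rw [← hasSuffix_mul_right_iff t, e] at h3
    rw [List.prod_append, List.prod_singleton]
    exact hasSuffix_trans h3 hl1

theorem sup_prod_of_normalForm (hΔ : S.delta ≠ 1) (L : List G)
    (hL : ∀ s ∈ L, S.IsProperSimple s) (hch : L.IsChain S.IsRightWeighted) :
    S.sup L.prod = L.length := by
  apply le_antisymm
  · clear hch
    induction L with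
    | nil => simp [sup_one hΔ]
    | cons s L ih =>
      have h1 := ih fun s' hs' => hL s' (List.mem_cons_of_mem _ hs')
      have h2 := sup_simple_le hΔ (hL s List.mem_cons_self).1.2
      have h3 := sup_mul_le hΔ s L.prod
      rw [List.prod_cons, List.length_cons]
      push_cast
      omega
  · cases L with
    | nil => simp [sup_one hΔ]
    | cons s L =>
      by_contra! hlt
      rw [List.length_cons] at hlt
      have h1 : S.sup (s :: L).prod ≤ L.length := by push_cast at hlt; omega
      rw [sup_le_iff hΔ, ← zpow_hasSuffix_iff] at h1
      have h2 := zpow_suffix_of_normalForm [s] L hL hch h1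
        (by simp [HasSuffix, S.pos.one_mem])
      have hs := hL s List.mem_cons_self
      refine hs.2.1 (S.eq_one_of_inv_mem s hs.1.1 ?_)
      simpa [HasSuffix] using h2

theorem not_delta_prefix_prod (hΔ : S.delta ≠ 1) (L : List G)
    (hL : ∀ s ∈ L, S.IsProperSimple s) (hch : L.IsChain S.IsRightWeighted) :
    ¬ IsPrefix S.pos S.delta L.prod := by
  intro h
  rw [← hasSuffix_delta_iff] at h
  rcases List.eq_nil_or_concat' L with rfl | ⟨C, t, rfl⟩
  · exact hΔ (S.eq_one_of_inv_mem _ S.delta_mem (by simpa [HasSuffix] using h))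
  · have h1 := simple_suffix_of_normalForm C hL hch
      (by simp [HasSuffix, S.pos.one_mem]) h
    have ht := hL t (by simp)
    have h2 := ht.hasSuffix
    refine ht.2.2 (eq_of_mul_inv_eq_one (S.eq_one_of_inv_mem _ h1 ?_))
    simpa [HasSuffix] using h2

/-! ### Powers of a right-rigid element -/

variable (S) in
/-- The properties of a right-rigid element `x` of infimum `0` and length `r` that govern its
axis: all its powers are free of `Δ`, their suprema are additive, and the complement in `x^(k+1)`
of a positive prefix that does not begin with `x` has supremum larger than `k * r`. -/
structure HasRigidPowers (x : G) (r : ℕ) : Prop where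
  delta_ne_one : S.delta ≠ 1
  pos_mem : x ∈ S.pos
  one_le : 1 ≤ r
  sup_pow : ∀ k : ℕ, S.sup (x ^ k) = k * r
  not_delta : ∀ k : ℕ, ¬ IsPrefix S.pos S.delta (x ^ k)
  lt_sup : ∀ (k : ℕ) (d : G), d ∈ S.pos → IsPrefix S.pos d (x ^ (k + 1)) →
    ¬ IsPrefix S.pos x d → (k * r : ℤ) < S.sup (d⁻¹ * x ^ (k + 1))

/-- Rigidity says that the right normal form of `x^k` is the `k`-fold concatenation of that
of `x`. -/
theorem normalForm_flatten_replicate {L : List G} (hne : L ≠ [])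
    (hL : ∀ s ∈ L, S.IsProperSimple s) (hch : L.IsChain S.IsRightWeighted)
    (hrig : S.IsRightWeighted (L.getLast hne) (L.head hne)) (k : ℕ) :
    (∀ s ∈ (List.replicate k L).flatten, S.IsProperSimple s) ∧
      (List.replicate k L).flatten.IsChain S.IsRightWeighted := by
  constructor
  · intro s hs
    obtain ⟨l, hl, hsl⟩ := List.mem_flatten.1 hs
    rw [List.eq_of_mem_replicate hl] at hsl
    exact hL s hsl
  · induction k with
    | zero => simp
    | succ k ih =>
      rw [List.replicate_succ, List.flatten_cons, List.isChain_append]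
      refine ⟨hch, ih, fun a ha b hb => ?_⟩
      cases k with
      | zero => simp at hb
      | succ k =>
        rw [List.replicate_succ, List.flatten_cons, List.head?_append_of_ne_nil _ hne,
          List.head?_eq_some_head hne] at hb
        rw [List.getLast?_eq_some_getLast hne] at ha
        simp only [Option.mem_def, Option.some.injEq] at ha hb
        rwa [← ha, ← hb]

theorem hasRigidPowers {x : G} (hinf : S.inf x = 0) (hrigid : S.IsRightRigid x) :
    ∃ r : ℕ, S.HasRigidPowers x r ∧ S.canonicalLength x = r := by
  obtain ⟨L, hne, ⟨hL, hch, hprod⟩, hrig⟩ := hrigid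
  rw [hinf, zpow_zero, mul_one] at hprod
  have hΔ : S.delta ≠ 1 := by
    intro h
    obtain ⟨⟨h1, h2⟩, h3, -⟩ := hL _ (List.head_mem hne)
    refine h3 (S.eq_one_of_inv_mem _ h1 ?_)
    rw [h] at h2
    simpa [IsPrefix] using h2
  have hw : S.IsRightWeighted (L.getLast hne) (L.head hne) := by
    have e : S.tauPow (S.inf x) (L.getLast hne) = L.getLast hne := by
      simp [tauPow, hinf]
    rw [e] at hrig
    exact ⟨hrig.2.1, hrig.1, fun z h1 h2 => hrig.2.2 z h2 h1⟩
  have hnf := normalForm_flatten_replicate hne hL hch hw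
  have hpow (k : ℕ) : x ^ k = (List.replicate k L).flatten.prod := by
    rw [hprod, List.prod_flatten]
    simp
  have hlen (k : ℕ) : (List.replicate k L).flatten.length = k * L.length := by
    simp
  have hsup (k : ℕ) : S.sup (x ^ k) = k * L.length := by
    rw [hpow, sup_prod_of_normalForm hΔ _ (hnf k).1 (hnf k).2, hlen]
    push_cast
    rfl
  have hxpos : x ∈ S.pos := hprod ▸ list_prod_mem hL
  refine ⟨L.length, ⟨hΔ, hxpos, List.length_pos_iff.2 hne, hsup, fun k => ?_,
    fun k d hd hdx hxd => ?_⟩, ?_⟩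
  · rw [hpow]
    exact not_delta_prefix_prod hΔ _ (hnf k).1 (hnf k).2
  · by_contra! hle
    refine hxd ?_
    have h1 : HasSuffix S.pos (x ^ k) (d⁻¹ * x ^ (k + 1)) := by
      rw [hpow k]
      have e : L ++ (List.replicate k L).flatten = (List.replicate (k + 1) L).flatten := by
        rw [List.replicate_succ, List.flatten_cons]
      apply zpow_suffix_of_normalForm L
      · rw [e]; exact (hnf (k + 1)).1
      · rw [e]; exact (hnf (k + 1)).2
      · rw [zpow_hasSuffix_iff, ← sup_le_iff hΔ, hlen]
        push_cast
        exact hle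
      · rw [e, ← hpow]
        unfold HasSuffix
        convert hd using 1
        group
    unfold HasSuffix at h1
    unfold IsPrefix
    convert h1 using 1
    rw [pow_succ']
    group
  · have := hsup 1
    rw [pow_one] at this
    rw [canonicalLength, hinf, this]
    simp

end GarsideStructure

/-! ### Concatenated geodesics as quasi-geodesics -/

/-- Two geodesics meeting at a point form a `(2, 0)`-quasi-geodesic if each point of the first and
each point of the second are at least as far apart as either is from the meeting point. -/
theorem IsMorseConstant.infDist_le_of_geodesics {X : Type*} [MetricSpace X] {γ : ℤ → X} {M : ℝ}
    (hM : IsMorseConstant γ 2 0 M) {c₁ c₂ : ℕ → X} {n₁ n₂ : ℕ} (h : c₁ n₁ = c₂ 0)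
    (h0 : c₁ 0 ∈ Set.range γ) (hn : c₂ n₂ ∈ Set.range γ)
    (h₁ : ∀ s t, s ≤ t → t ≤ n₁ → dist (c₁ s) (c₁ t) = (t : ℝ) - s)
    (h₂ : ∀ s t, s ≤ t → t ≤ n₂ → dist (c₂ s) (c₂ t) = (t : ℝ) - s)
    (h₁₂ : ∀ s t, s ≤ n₁ → t ≤ n₂ →
      (n₁ : ℝ) - s ≤ dist (c₁ s) (c₂ t) ∧ (t : ℝ) ≤ dist (c₁ s) (c₂ t)) :
    Metric.infDist (c₁ n₁) (Set.range γ) ≤ M := by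
  set c : ℕ → X := fun i => if i ≤ n₁ then c₁ i else c₂ (i - n₁) with hc
  have hc1 (i : ℕ) (hi : i ≤ n₁) : c i = c₁ i := if_pos hi
  have hc2 (i : ℕ) : c (n₁ + i) = c₂ i := by
    rcases Nat.eq_zero_or_pos i with rfl | hi
    · rw [add_zero, hc1 _ le_rfl, h]
    · rw [hc]
      simp only
      rw [if_neg (by omega), Nat.add_sub_cancel_left]
  have main : ∀ s t : ℕ, s ≤ t → t ≤ n₁ + n₂ →
      ((t : ℝ) - s) / 2 ≤ dist (c s) (c t) ∧ dist (c s) (c t) ≤ 2 * ((t : ℝ) - s) := by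
    intro s t hst ht
    have hst' : (s : ℝ) ≤ t := by exact_mod_cast hst
    rcases le_total t n₁ with h1 | h1
    · rw [hc1 s (hst.trans h1), hc1 t h1, h₁ s t hst h1]
      constructor <;> linarith
    · obtain ⟨t, rfl⟩ := Nat.exists_eq_add_of_le h1
      rw [hc2]
      rcases le_total s n₁ with h2 | h2
      · have h2' : (s : ℝ) ≤ n₁ := by exact_mod_cast h2
        rw [hc1 s h2]
        obtain ⟨a1, a2⟩ := h₁₂ s t h2 (by omega)
        have a3 := dist_triangle (c₁ s) (c₁ n₁) (c₂ t)
        rw [h₁ s n₁ h2 le_rfl, h, h₂ 0 t (Nat.zero_le _) (by omega)] at a3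
        push_cast at a3 ⊢
        constructor <;> linarith [Nat.cast_nonneg (α := ℝ) t]
      · obtain ⟨s, rfl⟩ := Nat.exists_eq_add_of_le h2
        rw [hc2, h₂ s t (by omega) (by omega)]
        push_cast at hst' ⊢
        constructor <;> linarith
  have hq : IsQuasiGeodesic 2 0 (n₁ + n₂) c := by
    intro s t hs ht
    rcases le_total s t with hst | hst
    · have hst' : (s : ℝ) ≤ t := by exact_mod_cast hst
      rw [abs_sub_comm, abs_of_nonneg (by linarith)]
      have := main s t hst ht
      constructor <;> linarith
    · have hst' : (t : ℝ) ≤ s := by exact_mod_cast hst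
      rw [abs_of_nonneg (by linarith), dist_comm]
      have := main t s hst hs
      constructor <;> linarith
  have := hM (n₁ + n₂) c hq (by rwa [hc1 0 (Nat.zero_le _)]) (by rwa [hc2]) n₁ (by omega)
  rwa [hc1 n₁ le_rfl] at this

theorem IsMorseConstant.nonneg {X : Type*} [MetricSpace X] {γ : ℤ → X} {M : ℝ}
    (hM : IsMorseConstant γ 2 0 M) : 0 ≤ M := by
  refine Metric.infDist_nonneg.trans (hM 0 (fun _ => γ 0) ?_ ⟨0, rfl⟩ ⟨0, rfl⟩ 0 le_rfl)
  intro s t hs ht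
  obtain rfl : s = 0 := by omega
  obtain rfl : t = 0 := by omega
  simp

namespace GarsideStructure

variable {G : Type*} [Group G] {S : GarsideStructure G}

theorem not_delta_prefix_of_factor {c g f : G} (hc : c ∈ S.pos) (hf : f ∈ S.pos)
    (h : ¬ IsPrefix S.pos S.delta (c * g * f)) : ¬ IsPrefix S.pos S.delta g :=
  fun hg => h (prefix_trans (delta_prefix_mul hc hg) (S.prefix_mul_right _ hf))

theorem length_eq_sup (hΔ : S.delta ≠ 1) {g : G} (hg : g ∈ S.pos)
    (hgΔ : ¬ IsPrefix S.pos S.delta g) : S.canonicalLength g = S.sup g :=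
  le_antisymm (canonicalLength_le_sup hΔ hg) (sup_le_canonicalLength hΔ hgΔ)

theorem exists_vertex_geodesic (hΔ : S.delta ≠ 1) {a : G} (ha : a ∈ S.pos)
    (haΔ : ¬ IsPrefix S.pos S.delta a) {n : ℕ} (hn : S.sup a = n) :
    ∃ c : ℕ → G, c 0 = 1 ∧ c n = a ∧ ∀ i j, i ≤ j → j ≤ n →
      IsPrefix S.pos (c i) (c j) ∧ S.sup ((c i)⁻¹ * c j) = (j : ℤ) - i ∧
      ∀ g, dist (S.vertex (g * c i)) (S.vertex (g * c j)) = (j : ℝ) - i := by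
  obtain ⟨c, h0, hcn, hc⟩ := exists_geodesic hΔ ha hn
  refine ⟨c, h0, hcn, fun i j hij hjn => ⟨(hc i j hij hjn).1, (hc i j hij hjn).2, fun g => ?_⟩⟩
  have hi : c i ∈ S.pos := by
    have := (hc 0 i (Nat.zero_le _) (hij.trans hjn)).1
    rwa [h0, one_prefix_iff] at this
  have hj := (hc j n hjn le_rfl).1
  rw [hcn] at hj
  have hΔ' : ¬ IsPrefix S.pos S.delta ((c i)⁻¹ * c j) := by
    refine not_delta_prefix_of_factor hi hj ?_
    rwa [show c i * ((c i)⁻¹ * c j) * ((c j)⁻¹ * a) = a by group]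
  rw [dist_vertex hΔ, show (g * c i)⁻¹ * (g * c j) = (c i)⁻¹ * c j by group,
    length_eq_sup hΔ (hc i j hij hjn).1 hΔ', (hc i j hij hjn).2]
  push_cast
  rfl

/-- Since distances in `𝒳` are integers, an infimum of distances to the axis is attained. -/
theorem exists_near_axis (hΔ : S.delta ≠ 1) {x g : G} {M : ℝ}
    (h : Metric.infDist (S.vertex g) (Set.range (S.axisMap x)) ≤ M) :
    ∃ j : ℤ, (S.canonicalLength ((x ^ j)⁻¹ * g) : ℝ) ≤ M := by
  have h1 := lt_of_le_of_lt h (Int.lt_floor_add_one M)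
  rw [Metric.infDist_lt_iff (Set.range_nonempty _)] at h1
  obtain ⟨_, ⟨j, rfl⟩, hj⟩ := h1
  refine ⟨j, ?_⟩
  rw [axisMap, dist_comm, dist_vertex hΔ] at hj
  have : S.canonicalLength ((x ^ j)⁻¹ * g) ≤ ⌊M⌋ := by
    rw [← Int.lt_add_one_iff]
    exact_mod_cast hj
  exact Int.le_floor.1 this

/-! ### Elements that project to the origin of the axis -/

variable (S) in
/-- The positive element `b` represents a vertex of `𝒳` whose Garside-theoretical projection is
the vertex of `1`: `x` is not a prefix of `b`, and no `x^k * b` with `k ≥ 0` is divisible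
by `Δ`. -/
structure ProjectsToOne (x b : G) : Prop where
  pos_mem : b ∈ S.pos
  not_prefix : ¬ IsPrefix S.pos x b
  not_delta : ∀ k : ℕ, ¬ IsPrefix S.pos S.delta (x ^ k * b)

theorem ProjectsToOne.not_delta_prefix {x b : G} (hb : S.ProjectsToOne x b) :
    ¬ IsPrefix S.pos S.delta b := by
  simpa using hb.not_delta 0

theorem ProjectsToOne.of_prefix {x b e : G} (hb : S.ProjectsToOne x b) (he : e ∈ S.pos)
    (heb : IsPrefix S.pos e b) : S.ProjectsToOne x e where
  pos_mem := he
  not_prefix h := hb.not_prefix (prefix_trans h heb)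
  not_delta k h := hb.not_delta k (prefix_trans h ((S.prefix_mul_left_iff _).2 heb))

namespace HasRigidPowers

theorem projectsToOne_of_prefix_pow {x d : G} {r k : ℕ} (hx : S.HasRigidPowers x r)
    (hd : d ∈ S.pos) (hdx : IsPrefix S.pos d (x ^ k)) (hxd : ¬ IsPrefix S.pos x d) :
    S.ProjectsToOne x d where
  pos_mem := hd
  not_prefix := hxd
  not_delta j h := by
    refine hx.not_delta (j + k) (prefix_trans h ?_)
    rw [pow_add]
    exact (S.prefix_mul_left_iff _).2 hdx

theorem pow_mem {x : G} {r : ℕ} (hx : S.HasRigidPowers x r) (k : ℕ) : x ^ k ∈ S.pos :=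
  S.pos.pow_mem hx.pos_mem k

/-- An element that projects to `1` and is at distance at most `M` from the axis is at distance at
most `(r + 1) * M` from the vertex of `1`. -/
theorem sup_le_of_near_axis {x e : G} {r : ℕ} (hx : S.HasRigidPowers x r)
    (he : S.ProjectsToOne x e) {M : ℝ} (hM : 0 ≤ M) {j : ℤ}
    (hj : (S.canonicalLength ((x ^ j)⁻¹ * e) : ℝ) ≤ M) : (S.sup e : ℝ) ≤ (r + 1) * M := by
  have hΔ := hx.delta_ne_one
  have hr : (1 : ℝ) ≤ r := by exact_mod_cast hx.one_le
  rcases le_or_gt j 0 with h | h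
  · obtain ⟨k, hk⟩ := Int.eq_ofNat_of_zero_le (show 0 ≤ -j by omega)
    rw [← zpow_neg, hk, zpow_natCast] at hj
    have h1 := sup_le_sup_mul_left hΔ (hx.pow_mem k) e
    have h2 := sup_le_canonicalLength hΔ (he.not_delta k)
    have h3 : (S.sup e : ℝ) ≤ S.canonicalLength (x ^ k * e) := by exact_mod_cast h1.trans h2
    nlinarith
  · obtain ⟨k, hk⟩ := Int.eq_ofNat_of_zero_le (show 0 ≤ j - 1 by omega)
    obtain rfl : j = ((k + 1 : ℕ) : ℤ) := by push_cast; omega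
    rw [zpow_natCast] at hj
    obtain ⟨d, hd⟩ := S.exists_gcp e (x ^ (k + 1))
    have hdpos : d ∈ S.pos := S.one_prefix_iff.1 (hd.2.2 1 (S.one_prefix_iff.2 he.pos_mem)
      (S.one_prefix_iff.2 (hx.pow_mem _)))
    have h1 := hx.lt_sup k d hdpos hd.2.1 fun h => he.not_prefix (prefix_trans h hd.1)
    have h2 := sup_add_sup_le_length hΔ he.pos_mem (hx.pow_mem (k + 1)) he.not_delta_prefix
      (hx.not_delta _) hd
    have h3 := sup_nonneg hΔ hd.1
    have h4 := canonicalLength_inv hΔ ((x ^ (k + 1))⁻¹ * e)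
    rw [mul_inv_rev, inv_inv] at h4
    have h5 := canonicalLength_mul_le hΔ (x ^ (k + 1)) ((x ^ (k + 1))⁻¹ * e)
    rw [mul_inv_cancel_left] at h5
    have h6 := sup_le_canonicalLength hΔ he.not_delta_prefix
    have h7 := canonicalLength_le_sup hΔ (hx.pow_mem (k + 1))
    rw [hx.sup_pow] at h7
    have h8 : (k * r : ℤ) + 1 ≤ S.canonicalLength ((x ^ (k + 1))⁻¹ * e) := by omega
    have h9 : (S.sup e : ℤ) ≤ ((k + 1 : ℕ) : ℤ) * r + S.canonicalLength ((x ^ (k + 1))⁻¹ * e) := by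
      omega
    have h8' : (k * r : ℝ) + 1 ≤ S.canonicalLength ((x ^ (k + 1))⁻¹ * e) := by exact_mod_cast h8
    have h9' : (S.sup e : ℝ) ≤
        ((k + 1 : ℕ) : ℝ) * r + S.canonicalLength ((x ^ (k + 1))⁻¹ * e) := by exact_mod_cast h9
    push_cast at h9'
    have h10 : (0 : ℝ) ≤ k * r := by positivity
    -- `sup e ≤ (k * r + 1) + M + (r - 1)` and `(M - 1) * (r - 1) ≥ 0`.
    nlinarith [mul_nonneg (show 0 ≤ M - 1 by linarith) (show (0 : ℝ) ≤ r - 1 by linarith)]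

/-- A prefix `d` of a power of `x` that does not begin with `x` is short: the path from `1` through
`d` to `x^k` is a quasi-geodesic, because a product of positive factors of `x^k` is at least as
long as either of them. -/
theorem sup_le_of_prefix_pow {x d : G} {r k : ℕ} (hx : S.HasRigidPowers x r) {M : ℝ}
    (hM : IsMorseConstant (S.axisMap x) 2 0 M) (hd : d ∈ S.pos)
    (hdx : IsPrefix S.pos d (x ^ k)) (hxd : ¬ IsPrefix S.pos x d) :
    (S.sup d : ℝ) ≤ (r + 1) * M := by
  have hΔ := hx.delta_ne_one
  have hdp := hx.projectsToOne_of_prefix_pow hd hdx hxd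
  obtain ⟨n₁, hn₁⟩ := Int.eq_ofNat_of_zero_le (sup_nonneg hΔ hd)
  obtain ⟨n₂, hn₂⟩ := Int.eq_ofNat_of_zero_le (sup_nonneg hΔ hdx)
  have heΔ : ¬ IsPrefix S.pos S.delta (d⁻¹ * x ^ k) := by
    refine not_delta_prefix_of_factor hd S.pos.one_mem ?_
    rw [mul_inv_cancel_left, mul_one]
    exact hx.not_delta k
  obtain ⟨c₁, h₁0, h₁n, h₁⟩ := exists_vertex_geodesic hΔ hd hdp.not_delta_prefix hn₁
  obtain ⟨c₂, h₂0, h₂n, h₂⟩ := exists_vertex_geodesic hΔ hdx heΔ hn₂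
  have key := hM.infDist_le_of_geodesics (c₁ := fun i => S.vertex (c₁ i))
    (c₂ := fun i => S.vertex (d * c₂ i)) (n₁ := n₁) (n₂ := n₂) (by simp [h₁n, h₂0])
    ⟨0, by simp [axisMap, h₁0]⟩ ⟨k, by simp [axisMap, h₂n]⟩
    (fun s t hst ht => by simpa using (h₁ s t hst ht).2.2 1)
    (fun s t hst ht => (h₂ s t hst ht).2.2 d) (by
      intro s t hs ht
      obtain ⟨a1, a2, -⟩ := h₁ s n₁ hs le_rfl
      obtain ⟨b1, b2, -⟩ := h₂ 0 t (Nat.zero_le _) ht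
      obtain ⟨b3, -, -⟩ := h₂ t n₂ ht le_rfl
      obtain ⟨a3, -, -⟩ := h₁ 0 s (Nat.zero_le _) hs
      rw [h₁0, one_prefix_iff] at a3
      rw [h₁n] at a1 a2
      rw [h₂0, one_prefix_iff] at b1
      rw [h₂0, inv_one, one_mul] at b2
      rw [h₂n] at b3
      have hpos : (c₁ s)⁻¹ * d * c₂ t ∈ S.pos := S.pos.mul_mem a1 b1
      have hfree : ¬ IsPrefix S.pos S.delta ((c₁ s)⁻¹ * d * c₂ t) := by
        refine not_delta_prefix_of_factor a3 b3 ?_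
        rw [show c₁ s * ((c₁ s)⁻¹ * d * c₂ t) * ((c₂ t)⁻¹ * (d⁻¹ * x ^ k)) = x ^ k by group]
        exact hx.not_delta k
      rw [dist_vertex hΔ, ← mul_assoc, length_eq_sup hΔ hpos hfree]
      have u1 := sup_le_sup_mul_right hΔ b1 ((c₁ s)⁻¹ * d)
      have u2 := sup_le_sup_mul_left hΔ a1 (c₂ t)
      rw [a2] at u1
      rw [b2] at u2
      push_cast at u2
      rw [sub_zero] at u2
      exact ⟨by exact_mod_cast u1, by exact_mod_cast u2⟩)
  simp only [h₁n] at key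
  obtain ⟨j, hj⟩ := exists_near_axis hΔ key
  exact hx.sup_le_of_near_axis hdp hM.nonneg hj

/-- If `e` projects to `1` and `x^i * e` is no longer than `x^i`, then `e` is short: the path from
`1` through `x^i * e` to `x^i` is a quasi-geodesic. -/
theorem sup_le_of_sup_pow_mul_le {x e : G} {r i : ℕ} (hx : S.HasRigidPowers x r) {M : ℝ}
    (hM : IsMorseConstant (S.axisMap x) 2 0 M) (he : S.ProjectsToOne x e)
    (hsup : S.sup (x ^ i * e) ≤ i * r) : (S.sup e : ℝ) ≤ (r + 1) * M := by
  have hΔ := hx.delta_ne_one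
  have hcpos : x ^ i * e ∈ S.pos := S.pos.mul_mem (hx.pow_mem i) he.pos_mem
  have hn₁ : S.sup (x ^ i * e) = ((i * r : ℕ) : ℤ) := by
    have := sup_le_sup_mul_right hΔ he.pos_mem (x ^ i)
    rw [hx.sup_pow] at this
    push_cast
    omega
  obtain ⟨n₂, hn₂⟩ := Int.eq_ofNat_of_zero_le (sup_nonneg hΔ he.pos_mem)
  obtain ⟨c₁, h₁0, h₁n, h₁⟩ := exists_vertex_geodesic hΔ hcpos (he.not_delta i) hn₁
  obtain ⟨c₂, h₂0, h₂n, h₂⟩ := exists_vertex_geodesic hΔ he.pos_mem he.not_delta_prefix hn₂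
  have key := hM.infDist_le_of_geodesics (c₁ := fun j => S.vertex (c₁ j))
    (c₂ := fun j => S.vertex (x ^ i * c₂ (n₂ - j))) (n₁ := i * r) (n₂ := n₂)
    (by simp [h₁n, h₂n]) ⟨0, by simp [axisMap, h₁0]⟩ ⟨i, by simp [axisMap, h₂0]⟩
    (fun s t hst ht => by simpa using (h₁ s t hst ht).2.2 1)
    (fun s t hst ht => by
      rw [dist_comm, (h₂ (n₂ - t) (n₂ - s) (by omega) (by omega)).2.2 (x ^ i),
        Nat.cast_sub ht, Nat.cast_sub (hst.trans ht)]
      ring) (by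
      intro s t hs ht
      obtain ⟨a1, a2, -⟩ := h₁ s (i * r) hs le_rfl
      obtain ⟨a3, a4, -⟩ := h₁ 0 s (Nat.zero_le _) hs
      rw [h₁0, one_prefix_iff] at a3
      rw [h₁0, inv_one, one_mul] at a4
      rw [h₁n] at a1 a2
      obtain ⟨b1, b2, -⟩ := h₂ (n₂ - t) n₂ (Nat.sub_le _ _) le_rfl
      obtain ⟨b3, -, -⟩ := h₂ 0 (n₂ - t) (Nat.zero_le _) (Nat.sub_le _ _)
      rw [h₂0, one_prefix_iff] at b3
      rw [h₂n] at b1 b2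
      rw [Nat.cast_sub ht] at b2
      set p := c₁ s
      set q := c₂ (n₂ - t)
      have hqpos : x ^ i * q ∈ S.pos := S.pos.mul_mem (hx.pow_mem i) b3
      have hqc : IsPrefix S.pos (x ^ i * q) (x ^ i * e) := (S.prefix_mul_left_iff _).2 b1
      obtain ⟨m, hm⟩ := S.exists_gcp p (x ^ i * q)
      have hd := sup_add_sup_le_length hΔ a3 hqpos (fun h => he.not_delta i (prefix_trans h a1))
        (fun h => he.not_delta i (prefix_trans h hqc)) hm
      -- The complement of `m` in `x^i * q` accounts for the part of the first geodesic
      -- beyond `p`.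
      have d1 : (i * r : ℤ) - s ≤ S.sup (m⁻¹ * (x ^ i * q)) := by
        have e1 := sup_mono hΔ hm.1
        have e2 := sup_mul_le hΔ m (m⁻¹ * (x ^ i * q))
        have e3 := sup_le_sup_mul_right hΔ b3 (x ^ i)
        rw [mul_inv_cancel_left] at e2
        rw [hx.sup_pow] at e3
        push_cast at a4
        omega
      -- From `p ≼ m * Δ^σ`, with `σ` the supremum of the complement of `m` in `p`, follows
      -- `x^i * e ≼ x^i * q * Δ^(σ + i * r - s)`.
      have d2 : (t : ℤ) ≤ S.sup (m⁻¹ * p) + (i * r - s) := by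
        have f2 : IsPrefix S.pos p (m * S.delta ^ S.sup (m⁻¹ * p)) := by
          have := (S.prefix_mul_left_iff m).2 (prefix_sup hΔ (m⁻¹ * p))
          rwa [mul_inv_cancel_left] at this
        have f3 := prefix_trans f2 (S.prefix_mul_zpow hm.2.1 (S.sup (m⁻¹ * p)))
        have f4 : S.sup ((x ^ i * q)⁻¹ * p) ≤ S.sup (m⁻¹ * p) := by
          rw [sup_le_iff hΔ, ← S.prefix_mul_left_iff (x ^ i * q), mul_inv_cancel_left]
          exact f3
        have f5 := sup_mul_le hΔ ((x ^ i * q)⁻¹ * p) (p⁻¹ * (x ^ i * e))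
        rw [show (x ^ i * q)⁻¹ * p * (p⁻¹ * (x ^ i * e)) = q⁻¹ * e by group, a2, b2] at f5
        push_cast at f5
        omega
      have hd1 : (i * r : ℤ) - s ≤ S.canonicalLength (p⁻¹ * (x ^ i * q)) := by
        have := sup_nonneg hΔ hm.1
        omega
      have hd2 : (t : ℤ) ≤ S.canonicalLength (p⁻¹ * (x ^ i * q)) := by omega
      rw [dist_vertex hΔ]
      exact ⟨by exact_mod_cast hd1, by exact_mod_cast hd2⟩)
  simp only [h₁n] at key
  obtain ⟨j, hj⟩ := exists_near_axis hΔ key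
  refine hx.sup_le_of_near_axis he hM.nonneg (j := j - i) ?_
  rwa [show (x ^ (j - (i : ℤ)))⁻¹ * e = (x ^ j)⁻¹ * (x ^ i * e) by
    rw [zpow_sub, zpow_natCast]; group]

end HasRigidPowers

/-! ### The projection -/

theorem rep_eq_self (hΔ : S.delta ≠ 1) {g : G} (hg : g ∈ S.pos)
    (hgΔ : ¬ IsPrefix S.pos S.delta g) : S.rep g = g := by
  rw [rep, (inf_eq_zero_iff hΔ).2 ⟨hg, hgΔ⟩, neg_zero, zpow_zero, mul_one]

theorem inf_mul_zpow (hΔ : S.delta ≠ 1) (g : G) (k : ℤ) :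
    S.inf (g * S.delta ^ k) = S.inf g + k := by
  have h1 : ∀ (g : G) (k : ℤ), S.inf (g * S.delta ^ k) ≤ S.inf g + k := fun g k => by
    have := inf_mul_le hΔ g (S.delta ^ k)
    have := (sup_le_iff hΔ).2 (S.prefix_refl (S.delta ^ k))
    omega
  have h2 := h1 (g * S.delta ^ k) (-k)
  rw [mul_assoc, ← zpow_add, add_neg_cancel, zpow_zero, mul_one] at h2
  have := h1 g k
  omega

namespace HasRigidPowers

/-- Every vertex is a translate by a power of `x` of a vertex that projects to `1`. The infima of
the `x^k * h` are bounded above; once they have reached their maximum, powers of `x` can be split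
off, and this stops for reasons of length. -/
theorem exists_eq_zpow_mul {x : G} {r : ℕ} (hx : S.HasRigidPowers x r) (h : G) :
    ∃ (n : ℤ) (b : G) (p : ℤ), h = x ^ n * b * S.delta ^ p ∧ S.ProjectsToOne x b := by
  have hΔ := hx.delta_ne_one
  obtain ⟨i, ⟨N, hN⟩, hmax⟩ : ∃ i, (∃ N : ℕ, S.inf (x ^ N * h) = i) ∧
      ∀ z, (∃ N : ℕ, S.inf (x ^ N * h) = z) → z ≤ i := by
    refine Int.exists_greatest_of_bdd ⟨S.sup h, ?_⟩ ⟨_, 0, rfl⟩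
    rintro z ⟨N, rfl⟩
    have h1 := inf_mul_le hΔ (x ^ N) h
    have h2 := (inf_eq_zero_iff hΔ).2 ⟨hx.pow_mem N, hx.not_delta N⟩
    omega
  set b₁ := x ^ N * h * S.delta ^ (-i) with hb₁
  have hb₁Δ : ∀ k : ℕ, ¬ IsPrefix S.pos S.delta (x ^ k * b₁) := by
    intro k hk
    rw [← zpow_one S.delta, ← le_inf_iff hΔ, hb₁,
      show x ^ k * (x ^ N * h * S.delta ^ (-i)) = x ^ (k + N) * h * S.delta ^ (-i) by
        rw [pow_add]; group, inf_mul_zpow hΔ] at hk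
    have := hmax _ ⟨k + N, rfl⟩
    omega
  have hb₁pos : b₁ ∈ S.pos := by
    rw [← inf_nonneg_iff hΔ, hb₁, inf_mul_zpow hΔ]
    omega
  obtain ⟨B, hB⟩ := Int.eq_ofNat_of_zero_le (sup_nonneg hΔ hb₁pos)
  have hbound : ∀ j : ℕ, IsPrefix S.pos (x ^ j) b₁ → j ≤ B := by
    intro j hj
    have h1 := sup_mono hΔ hj
    rw [hx.sup_pow, hB] at h1
    have h2 : j * r ≤ B := by exact_mod_cast h1
    exact (Nat.le_mul_of_pos_right j hx.one_le).trans h2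
  classical
  set j := Nat.findGreatest (fun j => IsPrefix S.pos (x ^ j) b₁) B with hj
  have hjp : IsPrefix S.pos (x ^ j) b₁ :=
    Nat.findGreatest_spec (P := fun j => IsPrefix S.pos (x ^ j) b₁) (Nat.zero_le B)
      (by simpa [one_prefix_iff] using hb₁pos)
  refine ⟨(j : ℤ) - N, (x ^ j)⁻¹ * b₁, i, ?_, hjp, fun hxb => ?_, fun k hk => ?_⟩
  · rw [hb₁, zpow_sub, zpow_natCast, zpow_natCast]
    have : x ^ j * (x ^ N)⁻¹ * (x ^ j)⁻¹ = (x ^ N)⁻¹ := by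
      rw [← zpow_natCast, ← zpow_natCast]; group
    rw [← mul_assoc, this]
    group
  · have h1 := (S.prefix_mul_left_iff (x ^ j)).2 hxb
    rw [mul_inv_cancel_left, ← pow_succ] at h1
    have := Nat.le_findGreatest (P := fun j => IsPrefix S.pos (x ^ j) b₁) (hbound _ h1) h1
    omega
  · refine hb₁Δ k ?_
    have h1 := delta_prefix_mul (hx.pow_mem j) hk
    rwa [show x ^ j * (x ^ k * ((x ^ j)⁻¹ * b₁)) = x ^ k * b₁ by
      rw [← mul_assoc, ← mul_assoc, ← pow_add, add_comm j k, pow_add, mul_inv_cancel_right]] at h1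

theorem isGreatest_of_eq {x b h : G} {r : ℕ} {n p : ℤ} (hx : S.HasRigidPowers x r)
    (hb : S.ProjectsToOne x b) (hh : h = x ^ n * b * S.delta ^ p) :
    IsGreatest {k : ℤ | ¬ IsPrefix S.pos x (S.rep (x ^ k * h))} (-n) := by
  have hΔ := hx.delta_ne_one
  have hrep (k : ℤ) : S.rep (x ^ k * h) = S.rep (x ^ (k + n) * b) := by
    rw [hh, show x ^ k * (x ^ n * b * S.delta ^ p) = x ^ (k + n) * b * S.delta ^ p by group,
      rep_mul_zpow]
  constructor
  · rw [Set.mem_ofPred_eq, hrep, neg_add_cancel, zpow_zero, one_mul,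
      rep_eq_self hΔ hb.pos_mem hb.not_delta_prefix]
    exact hb.not_prefix
  · intro k hk
    by_contra! hlt
    obtain ⟨l, hl⟩ := Int.eq_ofNat_of_zero_le (show 0 ≤ k + n - 1 by omega)
    obtain hl : k + n = ((l + 1 : ℕ) : ℤ) := by push_cast; omega
    refine hk ?_
    have hpos : x ^ l * b ∈ S.pos := S.pos.mul_mem (hx.pow_mem l) hb.pos_mem
    rw [hrep, hl, zpow_natCast, rep_eq_self hΔ (S.pos.mul_mem (hx.pow_mem _) hb.pos_mem)
      (hb.not_delta _), pow_succ', mul_assoc]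
    exact S.prefix_mul_right x hpos

theorem lambda_eq {x b h : G} {r : ℕ} {n p : ℤ} (hx : S.HasRigidPowers x r)
    (hb : S.ProjectsToOne x b) (hh : h = x ^ n * b * S.delta ^ p) : S.lambda x h = n := by
  rw [lambda, (hx.isGreatest_of_eq hb hh).csSup_eq, neg_neg]

/-- Every vertex has the form `x^n * b` with `b` projecting to `1`; its projection is then
`x^n`. -/
theorem exists_vertex_eq {x : G} {r : ℕ} (hx : S.HasRigidPowers x r) (v : S.Vertex) :
    ∃ (n : ℤ) (b : G), S.ProjectsToOne x b ∧ v = S.vertex (x ^ n * b) ∧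
      S.proj x v = S.vertex (x ^ n) := by
  obtain ⟨h, rfl⟩ := S.vertex_surjective v
  obtain ⟨n, b, p, hh, hb⟩ := hx.exists_eq_zpow_mul h
  refine ⟨n, b, hb, (S.vertex_eq_iff.2 ⟨p, hh⟩).symm, ?_⟩
  rw [proj_vertex, hx.lambda_eq hb hh]

theorem proj_axisMap {x : G} {r : ℕ} (hx : S.HasRigidPowers x r) (n : ℤ) :
    S.proj x (S.axisMap x n) = S.axisMap x n := by
  have hb : S.ProjectsToOne x 1 := by
    refine ⟨S.pos.one_mem, fun h => ?_, fun k => by simpa using hx.not_delta k⟩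
    have h1 := sup_mono hx.delta_ne_one h
    have h2 := hx.sup_pow 1
    have h3 := hx.one_le
    rw [pow_one] at h2
    rw [sup_one hx.delta_ne_one, h2] at h1
    push_cast at h1
    omega
  rw [axisMap, proj_vertex, hx.lambda_eq hb (n := n) (p := 0) (by simp)]

/-! ### Strong contraction -/

/-- An element that projects to `1` is almost as far from any point of the axis as from `1`. -/
theorem sup_sub_le_length {x b : G} {r : ℕ} (hx : S.HasRigidPowers x r) {M : ℝ}
    (hM : IsMorseConstant (S.axisMap x) 2 0 M) (hb : S.ProjectsToOne x b) (j : ℤ) :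
    (S.sup b : ℝ) - (r + 1) * M ≤ S.canonicalLength ((x ^ j)⁻¹ * b) := by
  have hΔ := hx.delta_ne_one
  rcases le_or_gt j 0 with h | h
  · obtain ⟨k, hk⟩ := Int.eq_ofNat_of_zero_le (show 0 ≤ -j by omega)
    rw [← zpow_neg, hk, zpow_natCast]
    have h1 := sup_le_sup_mul_left hΔ (hx.pow_mem k) b
    have h2 := sup_le_canonicalLength hΔ (hb.not_delta k)
    have h3 : (S.sup b : ℝ) ≤ S.canonicalLength (x ^ k * b) := by exact_mod_cast h1.trans h2
    have h4 : 0 ≤ ((r : ℝ) + 1) * M := mul_nonneg (by positivity) hM.nonneg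
    linarith
  · obtain ⟨k, rfl⟩ := Int.eq_ofNat_of_zero_le h.le
    rw [zpow_natCast]
    obtain ⟨d, hd⟩ := S.exists_gcp (x ^ k) b
    have hdpos : d ∈ S.pos := S.one_prefix_iff.1 (hd.2.2 1 (S.one_prefix_iff.2 (hx.pow_mem _))
      (S.one_prefix_iff.2 hb.pos_mem))
    have h1 := hx.sup_le_of_prefix_pow hM hdpos hd.1 fun h =>
      hb.not_prefix (prefix_trans h hd.2.1)
    have h2 := sup_add_sup_le_length hΔ (hx.pow_mem k) hb.pos_mem (hx.not_delta _)
      hb.not_delta_prefix hd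
    have h3 := sup_nonneg hΔ hd.1
    have h4 := sup_mul_le hΔ d (d⁻¹ * b)
    rw [mul_inv_cancel_left] at h4
    have h5 : S.sup b ≤ S.sup d + S.canonicalLength ((x ^ k)⁻¹ * b) := by omega
    have h5' : (S.sup b : ℝ) ≤ S.sup d + S.canonicalLength ((x ^ k)⁻¹ * b) := by exact_mod_cast h5
    linarith

/-- A prefix of `x^k * b` that does not begin with `x` and is no longer than `x^k` is short. It is
a prefix of the greatest common prefix `c` of `x^k * b` and `Δ^(k * r)`, which is close to `x^k` by
`sup_le_of_sup_pow_mul_le`. -/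
theorem sup_le_of_prefix_pow_mul {x b m : G} {r k : ℕ} (hx : S.HasRigidPowers x r) {M : ℝ}
    (hM : IsMorseConstant (S.axisMap x) 2 0 M) (hb : S.ProjectsToOne x b) (hm : m ∈ S.pos)
    (hmb : IsPrefix S.pos m (x ^ k * b)) (hxm : ¬ IsPrefix S.pos x m)
    (hsup : S.sup m ≤ k * r) : (S.sup m : ℝ) ≤ 3 * ((r + 1) * M) := by
  have hΔ := hx.delta_ne_one
  obtain ⟨c, hc⟩ := S.exists_gcp (x ^ k * b) (S.delta ^ (k * r : ℤ))
  have hxc : IsPrefix S.pos (x ^ k) c := hc.2.2 _ (S.prefix_mul_right _ hb.pos_mem)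
    ((sup_le_iff hΔ).1 (hx.sup_pow k).le)
  have hmc : IsPrefix S.pos m c := hc.2.2 _ hmb ((sup_le_iff hΔ).1 hsup)
  have hcsup : S.sup c ≤ k * r := (sup_le_iff hΔ).2 hc.2.1
  have he : S.ProjectsToOne x ((x ^ k)⁻¹ * c) := by
    refine hb.of_prefix hxc ?_
    rw [← S.prefix_mul_left_iff (x ^ k), mul_inv_cancel_left]
    exact hc.1
  have hesup := hx.sup_le_of_sup_pow_mul_le (i := k) hM he (by rwa [mul_inv_cancel_left])
  obtain ⟨g, hg⟩ := S.exists_gcp m (x ^ k)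
  have hgpos : g ∈ S.pos := S.one_prefix_iff.1 (hg.2.2 1 (S.one_prefix_iff.2 hm)
    (S.one_prefix_iff.2 (hx.pow_mem _)))
  have hgsup := hx.sup_le_of_prefix_pow hM hgpos hg.2.1 fun h => hxm (prefix_trans h hg.1)
  -- Compare two estimates of the distance between `m` and `x^k`, through `g` and through `c`.
  have h1 := sup_add_sup_le_length hΔ hm (hx.pow_mem k)
    (fun h => hb.not_delta k (prefix_trans h hmb)) (hx.not_delta k) hg
  have h2 := sup_mul_le hΔ g (g⁻¹ * m)
  have h3 := sup_mul_le hΔ g (g⁻¹ * x ^ k)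
  rw [mul_inv_cancel_left] at h2 h3
  rw [hx.sup_pow] at h3
  have h4 := canonicalLength_mul_le hΔ (m⁻¹ * c) ((x ^ k)⁻¹ * c)⁻¹
  rw [show m⁻¹ * c * ((x ^ k)⁻¹ * c)⁻¹ = m⁻¹ * x ^ k by group, canonicalLength_inv hΔ] at h4
  have h5 := canonicalLength_le_sup hΔ hmc
  have h6 := canonicalLength_le_sup hΔ hxc
  have h7 := sup_le_sup_mul_left hΔ hm (m⁻¹ * c)
  rw [mul_inv_cancel_left] at h7
  have h8 : S.sup m ≤ 2 * S.sup g + S.sup ((x ^ k)⁻¹ * c) := by omega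
  have h8' : (S.sup m : ℝ) ≤ 2 * S.sup g + S.sup ((x ^ k)⁻¹ * c) := by exact_mod_cast h8
  linarith

/-- If `a` and `b` project to `1` and `k` is large, then the greatest common prefix of `a` and
`x^k * b` is short. Hence the distance between them is, up to an additive constant, at least the
distance of either to `1`. -/
theorem sup_sub_le_length_of_lt {x a b : G} {r k : ℕ} (hx : S.HasRigidPowers x r) {M : ℝ}
    (hM : IsMorseConstant (S.axisMap x) 2 0 M) (ha : S.ProjectsToOne x a)
    (hb : S.ProjectsToOne x b) (hk : 3 * (((r : ℝ) + 1) * M) < k * r) :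
    (S.sup a : ℝ) - 3 * ((r + 1) * M) ≤ S.canonicalLength (a⁻¹ * (x ^ k * b)) ∧
      (S.sup (x ^ k * b) : ℝ) - 3 * ((r + 1) * M) ≤
        S.canonicalLength (a⁻¹ * (x ^ k * b)) := by
  have hΔ := hx.delta_ne_one
  have hbpos : x ^ k * b ∈ S.pos := S.pos.mul_mem (hx.pow_mem k) hb.pos_mem
  obtain ⟨m, hm⟩ := S.exists_gcp a (x ^ k * b)
  have hmpos : m ∈ S.pos := S.one_prefix_iff.1 (hm.2.2 1 (S.one_prefix_iff.2 ha.pos_mem)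
    (S.one_prefix_iff.2 hbpos))
  have hxm : ¬ IsPrefix S.pos x m := fun h => ha.not_prefix (prefix_trans h hm.1)
  have hmsup : (S.sup m : ℝ) ≤ 3 * ((r + 1) * M) := by
    rcases le_or_gt (S.sup m) (k * r) with h | h
    · exact hx.sup_le_of_prefix_pow_mul hM hb hmpos hm.2.1 hxm h
    · -- Otherwise `m` has a prefix of supremum exactly `k * r`, which is too long.
      exfalso
      obtain ⟨n, hn⟩ := Int.eq_ofNat_of_zero_le (sup_nonneg hΔ hmpos)
      have hle : k * r ≤ n := by
        rw [hn] at h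
        exact_mod_cast h.le
      obtain ⟨c, hc0, hcn, hc⟩ := exists_geodesic hΔ hmpos hn
      obtain ⟨a1, a2⟩ := hc 0 (k * r) (Nat.zero_le _) hle
      obtain ⟨a3, -⟩ := hc (k * r) n hle le_rfl
      rw [hc0, one_prefix_iff] at a1
      rw [hc0, inv_one, one_mul] at a2
      rw [hcn] at a3
      push_cast at a2
      rw [sub_zero] at a2
      have := hx.sup_le_of_prefix_pow_mul hM hb a1 (prefix_trans a3 hm.2.1)
        (fun h => hxm (prefix_trans h a3)) a2.le
      rw [a2] at this
      push_cast at this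
      linarith
  have h1 := sup_add_sup_le_length hΔ ha.pos_mem hbpos ha.not_delta_prefix (hb.not_delta k) hm
  have h2 := sup_mul_le hΔ m (m⁻¹ * a)
  have h3 := sup_mul_le hΔ m (m⁻¹ * (x ^ k * b))
  rw [mul_inv_cancel_left] at h2 h3
  have h4 := sup_nonneg hΔ hm.1
  have h5 := sup_nonneg hΔ hm.2.1
  have h6 : S.sup a ≤ S.sup m + S.canonicalLength (a⁻¹ * (x ^ k * b)) := by omega
  have h7 : S.sup (x ^ k * b) ≤ S.sup m + S.canonicalLength (a⁻¹ * (x ^ k * b)) := by omega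
  have h6' : (S.sup a : ℝ) ≤ S.sup m + S.canonicalLength (a⁻¹ * (x ^ k * b)) := by
    exact_mod_cast h6
  have h7' : (S.sup (x ^ k * b) : ℝ) ≤ S.sup m + S.canonicalLength (a⁻¹ * (x ^ k * b)) := by
    exact_mod_cast h7
  constructor <;> linarith

theorem dist_axis {x : G} {r : ℕ} (hx : S.HasRigidPowers x r) (n : ℤ) (k : ℕ) :
    dist (S.vertex (x ^ n)) (S.vertex (x ^ (n + k))) = k * r := by
  have hΔ := hx.delta_ne_one
  rw [dist_vertex hΔ, show (x ^ n)⁻¹ * x ^ (n + (k : ℤ)) = x ^ k by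
    rw [zpow_add, inv_mul_cancel_left, zpow_natCast], length_eq_sup hΔ (hx.pow_mem k)
    (hx.not_delta k), hx.sup_pow]
  push_cast
  rfl

/-- If the projections of two vertices are far apart, then so are the vertices: their distance is,
up to an additive constant, at least the distance of either to the axis. -/
theorem infDist_sub_le_dist {x a b : G} {r k : ℕ} (hx : S.HasRigidPowers x r) {M : ℝ}
    (hM : IsMorseConstant (S.axisMap x) 2 0 M) (ha : S.ProjectsToOne x a)
    (hb : S.ProjectsToOne x b) (hk : 3 * (((r : ℝ) + 1) * M) < k * r) (n : ℤ) :
    Metric.infDist (S.vertex (x ^ n * a)) (S.axis x) - 3 * ((r + 1) * M) ≤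
        dist (S.vertex (x ^ n * a)) (S.vertex (x ^ (n + k) * b)) ∧
      Metric.infDist (S.vertex (x ^ (n + k) * b)) (S.axis x) - 3 * ((r + 1) * M) ≤
        dist (S.vertex (x ^ n * a)) (S.vertex (x ^ (n + k) * b)) := by
  have hΔ := hx.delta_ne_one
  obtain ⟨h1, h2⟩ := hx.sup_sub_le_length_of_lt hM ha hb hk
  have e : x ^ (n + (k : ℤ)) * b = x ^ n * (x ^ k * b) := by
    rw [zpow_add, zpow_natCast, mul_assoc]
  have hn : S.axisMap x n ∈ S.axis x := ⟨n, rfl⟩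
  have hd : ∀ c : G, c ∈ S.pos → ¬ IsPrefix S.pos S.delta c →
      Metric.infDist (S.vertex (x ^ n * c)) (S.axis x) ≤ S.sup c := by
    intro c hc hcΔ
    refine (Metric.infDist_le_dist_of_mem hn).trans (le_of_eq ?_)
    rw [axisMap, dist_comm, dist_vertex hΔ, inv_mul_cancel_left, length_eq_sup hΔ hc hcΔ]
  have h3 := hd a ha.pos_mem ha.not_delta_prefix
  have h4 := hd (x ^ k * b) (S.pos.mul_mem (hx.pow_mem k) hb.pos_mem) (hb.not_delta k)
  rw [e, dist_vertex hΔ, show (x ^ n * a)⁻¹ * (x ^ n * (x ^ k * b)) = a⁻¹ * (x ^ k * b) by group]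
  constructor <;> linarith

theorem isStronglyContracting_proj {x : G} {r : ℕ} (hx : S.HasRigidPowers x r) {M : ℝ}
    (hM : IsMorseConstant (S.axisMap x) 2 0 M) :
    IsStronglyContracting (5 * (((r : ℝ) + 1) * M)) (S.axis x) (S.proj x) := by
  have hΔ := hx.delta_ne_one
  have hD : 0 ≤ ((r : ℝ) + 1) * M := mul_nonneg (by positivity) hM.nonneg
  refine ⟨by linarith, fun v => ?_, ?_, fun v => ?_, fun u v huv => ?_⟩
  · obtain ⟨n, b, -, -, h⟩ := hx.exists_vertex_eq v
    exact h ▸ ⟨n, rfl⟩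
  · rintro _ ⟨n, rfl⟩
    rw [hx.proj_axisMap, dist_self]
    linarith
  · obtain ⟨n, b, hb, hv, h⟩ := hx.exists_vertex_eq v
    have h1 : (S.sup b : ℝ) - (r + 1) * M ≤ Metric.infDist v (S.axis x) := by
      refine (Metric.le_infDist (Set.range_nonempty _)).2 ?_
      rintro _ ⟨j, rfl⟩
      rw [hv, axisMap, dist_comm, dist_vertex hΔ,
        show (x ^ j)⁻¹ * (x ^ n * b) = (x ^ (j - n))⁻¹ * b by group]
      exact hx.sup_sub_le_length hM hb _
    have h2 : dist v (S.proj x v) = S.sup b := by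
      rw [h, hv, dist_comm, dist_vertex hΔ, inv_mul_cancel_left,
        length_eq_sup hΔ hb.pos_mem hb.not_delta_prefix]
    linarith
  · obtain ⟨n, a, ha, hu, hpu⟩ := hx.exists_vertex_eq u
    obtain ⟨l, b, hb, hv, hpv⟩ := hx.exists_vertex_eq v
    by_contra! hlt
    rw [hpu, hpv] at hlt
    rcases le_total n l with h | h
    · obtain ⟨k, rfl⟩ := Int.exists_add_of_le h
      rw [hx.dist_axis] at hlt
      have := (hx.infDist_sub_le_dist hM ha hb (by linarith) n).2
      rw [← hu, ← hv] at this
      linarith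
    · obtain ⟨k, rfl⟩ := Int.exists_add_of_le h
      rw [dist_comm, hx.dist_axis] at hlt
      have := (hx.infDist_sub_le_dist hM hb ha (by linarith) l).1
      rw [← hu, ← hv, dist_comm] at this
      linarith

end HasRigidPowers

end GarsideStructure

/-- The first conjunct says that the maximum in the definition of `λ(h)` exists, that is,
that the projection `π` is well defined. -/
theorem propositionP {G : Type*} [Group G] (S : GarsideStructure G)
    (hfin : S.IsFiniteType) (hpure : S.IsDeltaPure)
    (x : G) (hinf : S.inf x = 0) (hrigid : S.IsRightRigid x) (hmorse : S.IsMorseElement x)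
    (M : ℝ) (hM : IsMorseConstant (S.axisMap x) 2 0 M) :
    (∀ h : G, IsGreatest {k : ℤ | ¬ IsPrefix S.pos x (S.rep (x ^ k * h))} (-S.lambda x h)) ∧
    IsStronglyContracting (5 * (((S.canonicalLength x : ℝ) + 1) * M)) (S.axis x) (S.proj x) := by
  obtain ⟨r, hx, hr⟩ := GarsideStructure.hasRigidPowers hinf hrigid
  refine ⟨fun h => ?_, ?_⟩
  · obtain ⟨n, b, p, hh, hb⟩ := hx.exists_eq_zpow_mul h
    rw [hx.lambda_eq hb hh]
    exact hx.isGreatest_of_eq hb hh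
  · rw [hr]
    exact hx.isStronglyContracting_proj hM
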